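/- Let $M$ be a smooth manifold of dimension $n\ge 1$ (Hausdorff, second countable) and let $N=TM\setminus\{0\}$ be its tangent bundle with the zero section removed, with projection $\pi:N\to M$. All objects are $C^\infty$. Let $J$ be the tangent structure on $N$, $J(\xi)=(u+t\,D\pi(\xi))'(0)$ for $\xi\in T_uN$, and $\mathbb{C}(u)=(u+tu)'(0)$ the Liouville vector field. Let $S$ be a semispray, i.e. a vector field on $N$ with $JS=\mathbb{C}$. For a $(1,1)$-tensor $A$ on $N$ put $\mathcal{L}_SA=\mathcal{L}_S\circ A-A\circ\mathcal{L}_S$, and let $$\Gamma=-\mathcal{L}_SJ,\quad h=\tfrac12(\mathrm{Id}-\mathcal{L}_SJ),\quad v=\tfrac12(\mathrm{Id}+\mathcal{L}_SJ),\quad \mathbb{F}=h\circ\mathcal{L}_Sh-J,\quad \Psi=h\circ\mathcal{L}_Sh+v\circ\mathcal{L}_Sv .$$ The dynamical covariant derivative $\nabla$ of $S$ is the tensor derivation on $N$ with $\nabla f=S(f)$ on functions and $\nabla X=h[S,hX]+v[S,vX]$ on vector fields; on a $k$-form $\omega$, and likewise on a vector valued $l$-form (an antisymmetric $(1,l)$-tensor)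 $A$, it is given by $$(\nabla\omega)(X_1,\dots,X_k)=\nabla(\omega(X_1,\dots,X_k))-\sum_{i=1}^k\omega(X_1,\dots,\nabla X_i,\dots,X_k).$$ For a vector valued $l$-form $A$ ($l\ge 0$) and a $k$-form $\alpha$, let $i_A\alpha=0$ if $k=0$ and, if $k\ge1$, $$i_A\alpha(X_1,\dots,X_{k+l-1})=\frac{1}{l!\,(k-1)!}\sum_{\sigma\in S_{k+l-1}}\operatorname{sign}(\sigma)\,\alpha\big(A(X_{\sigma(1)},\dots,X_{\sigma(l)}),X_{\sigma(l+1)},\dots,X_{\sigma(k+l-1)}\big),$$ and for a $(1,1)$-tensor $A$ let $d_A=i_A\circ d-d\circ i_A$. Theorem. The derivation $\nabla$ exists and is unique, and on vector fields $\nabla=\mathcal{L}_S+\Psi$, that is, $\nabla X=[S,X]+\Psi X$. Moreover: (i) $\nabla h=0$ and $\nabla v=0$, and $\nabla$ preserves the horizontal and the vertical distribution: if $hX=X$ then $h(\nabla X)=\nabla X$, and if $D\pi(X)=0$ then $D\pi(\nabla X)=0$. (ii) $\nabla J=0$ and $\nabla\mathbb{F}=0$. (iii) On $k$-forms, $k\ge0$: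 $d\nabla-\nabla d=d_\Psi$. (iv) On $k$-forms, $k\ge0$, and for every vector valued $l$-form $A$, $l\ge0$: $\nabla i_A-i_A\nabla=i_{\nabla A}$. In particular $\nabla i_A-i_A\nabla=0$ for $A\in\{h,v,J,\Gamma,\mathbb{F}\}$. -/

import Mathlib

open scoped Manifold ContDiff
open Bundle

noncomputable section

namespace TensorCalculus

section

variable {W : Type*} {k l m : ℕ} {X : Fin m → W} {p : Fin m} {x : W}

lemma front_update_lt (h : m = k + l) (hp : (p : ℕ) < l) :
    (fun i : Fin l => Function.update X p x ⟨i, by omega⟩) =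
      Function.update (fun i : Fin l => X ⟨i, by omega⟩) ⟨p, hp⟩ x := by
  funext i; simp only [Function.update_apply, Fin.ext_iff]

lemma front_update_lt' (h : m = k + l) (hp : (p : ℕ) < l) :
    (fun j : Fin k => Function.update X p x ⟨l + j, by omega⟩) =
      fun j : Fin k => X ⟨l + j, by omega⟩ := by
  funext j; rw [Function.update_of_ne]; rw [Ne, Fin.ext_iff]; simp only; omega

lemma front_update_ge (h : m = k + l) (hp : ¬ (p : ℕ) < l) :
    (fun i : Fin l => Function.update X p x ⟨i, by omega⟩) =
      fun i : Fin l => X ⟨i, by omega⟩ := by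
  funext j; rw [Function.update_of_ne]; rw [Ne, Fin.ext_iff]; simp only; omega

lemma front_update_ge' (h : m = k + l) (hp : ¬ (p : ℕ) < l) :
    (fun j : Fin k => Function.update X p x ⟨l + j, by omega⟩) =
      Function.update (fun j : Fin k => X ⟨l + j, by omega⟩) ⟨p - l, by omega⟩ x := by
  funext j; simp only [Function.update_apply, Fin.ext_iff]
  congr 1; simp only [eq_iff_iff]; omega

end

section Algebra

variable {R V : Type*} [CommRing R] [Algebra ℝ R] [AddCommGroup V] [Module R V]

/-- The multilinear map `X ↦ α(A(X₁, …, X_l), X_{l+1}, …, X_{k+l})` for a `(k+1)`-form `α`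
and a vector valued `l`-form `A`, where `m = k + l`. -/
def insertFront {k l m : ℕ} (h : m = k + l) (A : V [⋀^Fin l]→ₗ[R] V)
    (α : V [⋀^Fin (k + 1)]→ₗ[R] R) : MultilinearMap R (fun _ : Fin m => V) R where
  toFun X := α (Fin.cons (A fun i : Fin l => X ⟨i, by omega⟩)
    fun j : Fin k => X ⟨l + j, by omega⟩)
  map_update_add' := by
    intro inst X p x y
    obtain rfl : inst = instDecidableEqFin m := Subsingleton.elim _ _
    by_cases hp : (p : ℕ) < l
    · simp only [front_update_lt h hp, front_update_lt' h hp, A.map_update_add]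
      exact α.map_vecCons_add _ _ _
    · simp only [front_update_ge h hp, front_update_ge' h hp, Fin.cons_update, α.map_update_add]
  map_update_smul' := by
    intro inst X p f x
    obtain rfl : inst = instDecidableEqFin m := Subsingleton.elim _ _
    by_cases hp : (p : ℕ) < l
    · simp only [front_update_lt h hp, front_update_lt' h hp, A.map_update_smul]
      exact α.map_vecCons_smul _ _ _
    · simp only [front_update_ge h hp, front_update_ge' h hp, Fin.cons_update, α.map_update_smul]

/-- The inner product `i_A α` of a vector valued `l`-form `A` with a `k`-form `α`, a form of degree
`m = k + l - 1`: it is `0` for `k = 0`, and for `k ≥ 1`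
`i_A α(X₁, …, X_m) = 1 / (l! (k-1)!) ∑_σ sign(σ) α(A(X_σ(1), …, X_σ(l)), X_σ(l+1), …, X_σ(m))`. -/
def insertion {l m : ℕ} (A : V [⋀^Fin l]→ₗ[R] V) :
    {k : ℕ} → (h : m + 1 = k + l) → (V [⋀^Fin k]→ₗ[R] R) → V [⋀^Fin m]→ₗ[R] R
  | 0, _, _ => 0
  | k + 1, h, α => ((l.factorial * k.factorial : ℝ)⁻¹) •
      MultilinearMap.alternatization (insertFront (k := k) (by omega) A α)

lemma insertion_apply {k l m : ℕ} (h : m + 1 = (k + 1) + l) (A : V [⋀^Fin l]→ₗ[R] V)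
    (α : V [⋀^Fin (k + 1)]→ₗ[R] R) (X : Fin m → V) :
    insertion A h α X = ((l.factorial * k.factorial : ℝ)⁻¹) • ∑ σ : Equiv.Perm (Fin m),
      Equiv.Perm.sign σ • α (Fin.cons (A fun i : Fin l => X (σ ⟨i, by omega⟩))
        fun j : Fin k => X (σ ⟨l + j, by omega⟩)) := by
  simp [insertion, MultilinearMap.alternatization_apply, insertFront]

variable [Module ℝ V]

/-- A derivation `fn` of the ring of functions together with an `ℝ`-linear operator `vf` on vector
fields that satisfies the Leibniz rule over `fn`: the data that determine a tensor derivation. -/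
structure TensorDerivation (R V : Type*) [CommRing R] [Algebra ℝ R] [AddCommGroup V] [Module ℝ V]
    [Module R V] where
  fn : Derivation ℝ R R
  vf : V →ₗ[ℝ] V
  leibniz : ∀ (f : R) (X : V), vf (f • X) = f • vf X + fn f • X

/-- The extension by the Leibniz rule of a pair of operators `δ` on vector fields and `δ'` on the
values to alternating tensors:
`(DT)(X₁, …, X_k) = δ' (T(X₁, …, X_k)) - ∑ᵢ T(X₁, …, δ Xᵢ, …, X_k)`. -/
def leibnizExt {P : Type*} [AddCommGroup P] [Module R P] (a : R → R) (δ : V → V) (δ' : P → P)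
    (hδ : ∀ x y, δ (x + y) = δ x + δ y) (hδ' : ∀ x y, δ' (x + y) = δ' x + δ' y)
    (hl : ∀ (f : R) x, δ (f • x) = f • δ x + a f • x)
    (hl' : ∀ (f : R) x, δ' (f • x) = f • δ' x + a f • x)
    {k : ℕ} (T : V [⋀^Fin k]→ₗ[R] P) : V [⋀^Fin k]→ₗ[R] P where
  toFun X := δ' (T X) - ∑ i, T (Function.update X i (δ (X i)))
  map_update_add' := by
    intro inst X i x y
    obtain rfl : inst = instDecidableEqFin k := Subsingleton.elim _ _
    have key : ∀ j, T (Function.update (Function.update X i (x + y)) j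
        (δ (Function.update X i (x + y) j))) =
        T (Function.update (Function.update X i x) j (δ (Function.update X i x j))) +
        T (Function.update (Function.update X i y) j (δ (Function.update X i y j))) := by
      intro j
      by_cases h : j = i
      · subst h; simp [hδ]
      · simp only [Function.update_of_ne h]
        simp only [Function.update_comm (Ne.symm h), T.map_update_add]
    simp only [T.map_update_add, hδ', key, Finset.sum_add_distrib]
    abel
  map_update_smul' := by
    intro inst X i f x
    obtain rfl : inst = instDecidableEqFin k := Subsingleton.elim _ _
    have key : ∀ j, T (Function.update (Function.update X i (f • x)) j
        (δ (Function.update X i (f • x) j))) =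
        f • T (Function.update (Function.update X i x) j (δ (Function.update X i x j))) +
        if j = i then a f • T (Function.update X i x) else 0 := by
      intro j
      by_cases h : j = i
      · subst h; simp [hl]
      · simp only [Function.update_of_ne h, if_neg h, add_zero]
        simp only [Function.update_comm (Ne.symm h), T.map_update_smul]
    simp only [T.map_update_smul, hl', key, Finset.sum_add_distrib, Finset.sum_ite_eq',
      Finset.mem_univ, if_true, smul_sub, Finset.smul_sum]
    abel
  map_eq_zero_of_eq' := by
    intro X i j hij hne
    have h0 : δ' 0 = 0 := by simpa using hδ' 0 0
    have h1 : ∑ l, T (Function.update X l (δ (X l))) =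
        T (Function.update X i (δ (X i))) + T (Function.update X j (δ (X j))) := by
      apply Finset.sum_eq_add_of_mem i j (Finset.mem_univ _) (Finset.mem_univ _) hne
      rintro l - ⟨hi, hj⟩
      apply T.map_eq_zero_of_eq _ (i := i) (j := j) _ hne
      rw [Function.update_of_ne hi.symm, Function.update_of_ne hj.symm, hij]
    have h2 : Function.update X j (δ (X j)) =
        Function.update X i (δ (X i)) ∘ Equiv.swap i j := by
      funext l
      by_cases hi : l = i
      · subst hi; simp [Function.update_of_ne hne, Function.update_of_ne hne.symm, hij]
      · by_cases hj : l = j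
        · subst hj; simp [hij]
        · simp [Equiv.swap_apply_of_ne_of_ne hi hj, Function.update_of_ne hi,
            Function.update_of_ne hj]
    rw [T.map_eq_zero_of_eq X hij hne, h0, h1, h2, T.map_swap _ hne]
    simp

namespace TensorDerivation

variable (D : TensorDerivation R V)

/-- The action on `k`-forms:
`(Dα)(X₁, …, X_k) = D(α(X₁, …, X_k)) - ∑ᵢ α(X₁, …, D Xᵢ, …, X_k)`. -/
def onForm {k : ℕ} (α : V [⋀^Fin k]→ₗ[R] R) : V [⋀^Fin k]→ₗ[R] R :=
  leibnizExt D.fn D.vf D.fn D.vf.map_add D.fn.map_add D.leibniz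
    (fun f g => by simp [mul_comm]) α

/-- The action on vector valued `l`-forms:
`(DA)(X₁, …, X_l) = D(A(X₁, …, X_l)) - ∑ᵢ A(X₁, …, D Xᵢ, …, X_l)`. -/
def onVForm {l : ℕ} (A : V [⋀^Fin l]→ₗ[R] V) : V [⋀^Fin l]→ₗ[R] V :=
  leibnizExt D.fn D.vf D.vf D.vf.map_add D.vf.map_add D.leibniz D.leibniz A

/-- The action on `(1,1)`-tensors: `(DA)(X) = D(AX) - A(DX)`. -/
def onEnd (A : V →ₗ[R] V) : V →ₗ[R] V where
  toFun X := D.vf (A X) - A (D.vf X)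
  map_add' X Y := by simp only [map_add]; abel
  map_smul' f X := by
    simp only [map_smul, D.leibniz, map_add, smul_sub, RingHom.id_apply]; abel

/-- `D + B`, where the `(1,1)`-tensor `B` acts on functions by zero. -/
def addEnd (B : V →ₗ[R] V) [IsScalarTower ℝ R V] : TensorDerivation R V where
  fn := D.fn
  vf := D.vf + B.restrictScalars ℝ
  leibniz f X := by simp [D.leibniz]; abel

end TensorDerivation

/-- A `(1,1)`-tensor as a vector valued `1`-form. -/
def ofEnd (A : V →ₗ[R] V) : V [⋀^Fin 1]→ₗ[R] V := AlternatingMap.ofSubsingleton R V V 0 A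

lemma onVForm_ofEnd (D : TensorDerivation R V) (A : V →ₗ[R] V) :
    D.onVForm (ofEnd A) = ofEnd (D.onEnd A) := by
  ext X; simp [TensorDerivation.onVForm, TensorDerivation.onEnd, leibnizExt, ofEnd]

/-- Koszul's formula. For `D X = ℒ_X` it is the exterior derivative
`dα(X₀, …, X_k) = ∑ᵢ (-1)^i Xᵢ(α(X₀, …, X̂ᵢ, …, X_k))
  + ∑_{i<j} (-1)^{i+j} α([Xᵢ, Xⱼ], X₀, …, X̂ᵢ, …, X̂ⱼ, …, X_k)`,
where, in the second sum, `[Xᵢ, Xⱼ]` has been moved to the place of `Xᵢ`, at the cost of the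
sign `(-1)^i`. -/
def koszul (D : V → TensorDerivation R V) {k : ℕ} (α : V [⋀^Fin k]→ₗ[R] R)
    (X : Fin (k + 1) → V) : R :=
  ∑ i : Fin (k + 1), (-1) ^ (i : ℕ) * (D (X i)).fn (α (i.removeNth X)) +
    ∑ i : Fin (k + 1), ∑ j : Fin (k + 1), if i < j then
      (-1) ^ (j : ℕ) * α (j.removeNth (Function.update X i ((D (X i)).vf (X j)))) else 0

lemma koszul_zero_form (D : V → TensorDerivation R V) (α : V [⋀^Fin 0]→ₗ[R] R) (X : Fin 1 → V) :
    koszul D α X = (D (X 0)).fn (α ![]) := by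
  simp [koszul, Subsingleton.elim (Fin.tail X) ![]]

/-- Cartan's formula `i_X d = ℒ_X - d i_X`. -/
lemma koszul_cons (D : V → TensorDerivation R V) {k : ℕ} (α : V [⋀^Fin (k + 1)]→ₗ[R] R)
    (x : V) (Y : Fin (k + 1) → V) :
    koszul D α (Fin.cons x Y) = (D x).onForm α Y - koszul D (α.curryLeft x) Y := by
  have hr : ∀ (i : Fin (k + 1)) (y : V) (Z : Fin (k + 1) → V),
      i.succ.removeNth (Fin.cons y Z : Fin (k + 2) → V) = Matrix.vecCons y (i.removeNth Z) := by
    intro i y Z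
    funext l
    refine Fin.cases ?_ (fun l => ?_) l
    · simp [Fin.removeNth]
    · simp [Fin.removeNth]
  have h0 : (0 : Fin (k + 2)).removeNth (Fin.cons x Y : Fin (k + 2) → V) = Y := by
    funext l; simp [Fin.removeNth]
  have hu : ∀ (i : Fin (k + 1)) (y : V), α (Function.update Y i y) =
      (-1) ^ (i : ℕ) * α (Matrix.vecCons y (i.removeNth Y)) := by
    intro i y
    rw [← Fin.insertNth_removeNth, α.map_insertNth]
    simp
  simp only [koszul, TensorDerivation.onForm, leibnizExt, AlternatingMap.coe_mk,
    MultilinearMap.coe_mk]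
  rw [Fin.sum_univ_succ (n := k + 1), Fin.sum_univ_succ (n := k + 1)]
  simp only [Fin.sum_univ_succ (n := k + 1), Fin.cons_zero, Fin.cons_succ, h0, hr,
    Fin.update_cons_zero, ← Fin.cons_update,
    Fin.succ_lt_succ_iff, Fin.succ_pos, Fin.not_lt_zero, lt_irrefl, if_true, if_false,
    Fin.val_zero, Fin.val_succ, pow_zero, pow_succ, hu, AlternatingMap.curryLeft_apply_apply]
  simp only [mul_neg, neg_mul, mul_one, one_mul, zero_add, Finset.sum_neg_distrib]
  have hite : ∀ (p : Prop) [Decidable p] (r : R), (if p then -r else 0) = - if p then r else 0 := by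
    intro p _ r; split_ifs <;> simp
  simp only [hite, Finset.sum_neg_distrib]
  ring

/-- For a family `D X = ℒ_X` with the stated properties, Koszul's formula defines a form. -/
theorem exists_form_eq_koszul (D : V → TensorDerivation R V)
    (fn_add : ∀ x y f, (D (x + y)).fn f = (D x).fn f + (D y).fn f)
    (fn_smul : ∀ (f : R) x g, (D (f • x)).fn g = f * (D x).fn g)
    (vf_add : ∀ x y z, (D (x + y)).vf z = (D x).vf z + (D y).vf z)
    (vf_self : ∀ x, (D x).vf x = 0) {k : ℕ} (α : V [⋀^Fin k]→ₗ[R] R) :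
    ∃ η : V [⋀^Fin (k + 1)]→ₗ[R] R, ∀ X, η X = koszul D α X := by
  have koszul_add : ∀ {k : ℕ} (α β : V [⋀^Fin k]→ₗ[R] R) X,
      koszul D (α + β) X = koszul D α X + koszul D β X := by
    intro k α β X
    have hite : ∀ (p : Prop) [Decidable p] (r s : R),
        (if p then r + s else 0) = (if p then r else 0) + if p then s else 0 := by
      intro p _ r s; split_ifs <;> simp
    simp only [koszul, AlternatingMap.add_apply, map_add, mul_add, hite, Finset.sum_add_distrib]
    ring
  induction k with
  | zero =>
    refine ⟨AlternatingMap.ofSubsingleton R V R (0 : Fin 1)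
      { toFun := fun x => (D x).fn (α ![])
        map_add' := fun x y => fn_add x y _
        map_smul' := fun f x => fn_smul f x _ }, fun X => ?_⟩
    rw [koszul_zero_form]; rfl
  | succ k ih =>
    choose dd hdd using ih
    let G : V → V [⋀^Fin (k + 1)]→ₗ[R] R := fun x => (D x).onForm α - dd (α.curryLeft x)
    have hG : ∀ x Y, G x Y = koszul D α (Fin.cons x Y) := by
      intro x Y; rw [koszul_cons, ← hdd]; rfl
    have G_add : ∀ x y, G (x + y) = G x + G y := by
      intro x y
      ext Y
      rw [AlternatingMap.add_apply, hG, hG, hG, koszul_cons, koszul_cons, koszul_cons,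
        map_add, koszul_add]
      simp only [TensorDerivation.onForm, leibnizExt, AlternatingMap.coe_mk, MultilinearMap.coe_mk,
        fn_add, vf_add, α.map_update_add, Finset.sum_add_distrib]
      ring
    have G_self : ∀ x Z, G x (Fin.cons x Z) = 0 := by
      intro x Z
      rw [hG, koszul_cons]
      have h1 : (D x).onForm α (Fin.cons x Z) = (D x).onForm (α.curryLeft x) Z := by
        simp only [TensorDerivation.onForm, leibnizExt, AlternatingMap.coe_mk,
          MultilinearMap.coe_mk]
        rw [Fin.sum_univ_succ]
        simp only [Fin.cons_zero, Fin.cons_succ, ← Fin.cons_update, vf_self,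
          α.map_update_zero, zero_add, AlternatingMap.curryLeft_apply_apply]
        rfl
      rw [h1]
      cases k with
      | zero =>
        rw [koszul_zero_form]
        simp [TensorDerivation.onForm, leibnizExt, Subsingleton.elim Z ![]]
      | succ k =>
        rw [koszul_cons, α.curryLeft_same]
        simp [koszul]
    have G_swap : ∀ x y Z, G x (Fin.cons y Z) = - G y (Fin.cons x Z) := by
      intro x y Z
      have hc : ∀ a b c, G a (Fin.cons (b + c) Z) = G a (Fin.cons b Z) + G a (Fin.cons c Z) :=
        fun a b c => (G a).map_vecCons_add _ _ _
      have h := G_self (x + y) Z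
      rw [hc, G_add, AlternatingMap.add_apply, AlternatingMap.add_apply, G_self, G_self] at h
      linear_combination h
    have G_smul : ∀ (f : R) x, G (f • x) = f • G x := by
      intro f x
      ext Y
      rw [AlternatingMap.smul_apply, ← Fin.cons_self_tail Y, G_swap, G_swap x]
      have hc : ∀ a b, G a (Fin.cons (f • b) (Fin.tail Y)) = f • G a (Fin.cons b (Fin.tail Y)) :=
        fun a b => (G a).map_vecCons_smul _ _ _
      rw [hc, smul_neg]
    let Gl : V →ₗ[R] V [⋀^Fin (k + 1)]→ₗ[R] R := ⟨⟨G, G_add⟩, G_smul⟩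
    let M := LinearMap.uncurryLeft (M := fun _ : Fin (k + 2) => V)
      (AlternatingMap.toMultilinearMapLM (S := R) ∘ₗ Gl)
    have hM : ∀ X, M X = G (X 0) (Fin.tail X) := fun X => rfl
    have key : ∀ (X : Fin (k + 2) → V) (j : Fin (k + 1)), X 0 = X j.succ → M X = 0 := by
      intro X j h
      rw [hM]
      by_cases hj : j = 0
      · subst hj
        rw [← Fin.cons_self_tail (Fin.tail X)]
        have : Fin.tail X 0 = X 0 := h.symm
        rw [this, G_self]
      · have h2 := (G (X 0)).map_swap (Fin.tail X) (i := 0) (j := j) (Ne.symm hj)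
        rw [← Fin.cons_self_tail (Fin.tail X ∘ _)] at h2
        have : (Fin.tail X ∘ Equiv.swap 0 j) 0 = X 0 := by simp [Fin.tail, h]
        rw [this, G_self] at h2
        exact neg_eq_zero.1 h2.symm
    refine ⟨{ M with map_eq_zero_of_eq' := ?_ }, fun X => ?_⟩
    · intro X i j hij hne
      change M X = 0
      induction i using Fin.cases with
      | zero =>
        induction j using Fin.cases with
        | zero => exact absurd rfl hne
        | succ j => exact key X j hij
      | succ i =>
        induction j using Fin.cases with
        | zero => exact key X i hij.symm
        | succ j =>
          rw [hM]
          exact (G (X 0)).map_eq_zero_of_eq _ (i := i) (j := j) hij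
            (fun h => hne (congrArg Fin.succ h))
    · change M X = _
      rw [hM, hG, Fin.cons_self_tail]

end Algebra

section Manifold

variable {E : Type*} [NormedAddCommGroup E] [NormedSpace ℝ E]
  {H : Type*} [TopologicalSpace H] (I : ModelWithCorners ℝ E H)
  (N : Type*) [TopologicalSpace N] [ChartedSpace H N] [IsManifold I ∞ N]

/-- The ring of smooth real functions on `N`. -/
abbrev Fn : Type _ := C^∞⟮I, N; 𝓘(ℝ, ℝ), ℝ⟯

/-- The smooth vector fields on `N`, as smooth sections of the tangent bundle. -/
abbrev VField : Type _ := Cₛ^∞⟮I; E, (TangentSpace I : N → Type _)⟯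

variable {I N}

instance : SMul (Fn I N) (VField I N) where
  smul f X := ⟨fun u => f u • X u, f.contMDiff.smul_section X.contMDiff⟩

lemma smul_apply (f : Fn I N) (X : VField I N) (u : N) : (f • X) u = f u • X u := rfl

instance : Module (Fn I N) (VField I N) where
  one_smul X := by ext u; simp [smul_apply]
  mul_smul f g X := by ext u; simp [smul_apply, mul_smul]
  smul_zero f := by ext u; simp [smul_apply]
  smul_add f X Y := by ext u; simp [smul_apply]
  add_smul f g X := by ext u; simp [smul_apply, add_smul]
  zero_smul X := by ext u; simp [smul_apply]

instance : IsScalarTower ℝ (Fn I N) (VField I N) where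
  smul_assoc c f X := by ext u; simp [smul_apply, mul_smul]

/-- The function `X(f)`. -/
def VField.apply (X : VField I N) (f : Fn I N) : Fn I N :=
  ⟨fun u => mvfderiv I f u (X u), by
    have h := (f.contMDiff.contMDiff_tangentMap (m := ∞) le_rfl).comp X.contMDiff
    exact (contMDiff_snd_tangentBundle_modelSpace _ _).comp h⟩

lemma VField.apply_apply (X : VField I N) (f : Fn I N) (u : N) :
    X.apply f u = mvfderiv I f u (X u) := rfl

/-- A vector field as a derivation of the ring of smooth functions. -/
def VField.derivation (X : VField I N) : Derivation ℝ (Fn I N) (Fn I N) :=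
  Derivation.mk'
    { toFun := X.apply
      map_add' := fun f g => by
        ext u
        simp only [VField.apply_apply, ContMDiffMap.coe_add, Pi.add_apply]
        rw [mvfderiv_add (f.contMDiff.mdifferentiable (by simp) u)
          (g.contMDiff.mdifferentiable (by simp) u)]
        rfl
      map_smul' := fun c f => by
        ext u
        change mvfderiv I ((fun _ : N => c) • ⇑f) u (X u) = c * mvfderiv I f u (X u)
        rw [mvfderiv_smul mdifferentiableAt_const (f.contMDiff.mdifferentiable (by simp) u),
          mvfderiv_const]
        simp }
    (fun f g => by
      ext u
      change mvfderiv I (⇑f * ⇑g) u (X u) =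
        f u * mvfderiv I g u (X u) + g u * mvfderiv I f u (X u)
      rw [mvfderiv_mul (f.contMDiff.mdifferentiable (by simp) u)
        (g.contMDiff.mdifferentiable (by simp) u)]
      simp)

variable [CompleteSpace E]

/-- The Lie bracket `[X, Y]`. -/
def VField.bracket (X Y : VField I N) : VField I N :=
  ⟨VectorField.mlieBracket I X Y, by
    have h : (((⊤ : ℕ∞) : ℕ∞ω) + 1) = ∞ := rfl
    have : IsManifold I (((⊤ : ℕ∞) : ℕ∞ω) + 1) N := by rw [h]; infer_instance
    have : IsManifold I (minSmoothness ℝ 2) N := by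
      rw [minSmoothness_of_isRCLikeNormedField]; infer_instance
    have : IsManifold I (minSmoothness ℝ 3) N := by
      rw [minSmoothness_of_isRCLikeNormedField]; infer_instance
    exact ContDiff.mlieBracket_vectorField (m := ⊤) (n := ⊤) X.contMDiff Y.contMDiff (by simp)⟩

lemma VField.bracket_apply (X Y : VField I N) (u : N) :
    X.bracket Y u = VectorField.mlieBracket I X Y u := rfl

/-- The Lie derivative `ℒ_X`: `f ↦ X(f)` on functions and `Y ↦ [X, Y]` on vector fields. -/
def lieD (X : VField I N) : TensorDerivation (Fn I N) (VField I N) where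
  fn := X.derivation
  vf :=
    { toFun := X.bracket
      map_add' := fun Y Z => by
        ext u
        exact VectorField.mlieBracket_add_right Y.mdifferentiableAt Z.mdifferentiableAt
      map_smul' := fun c Y => by
        ext u
        exact VectorField.mlieBracket_const_smul_right Y.mdifferentiableAt }
  leibniz f Y := by
    ext u
    have h := VectorField.mlieBracket_smul_right (I := I) (V := X) (W := Y) (f := f) (x := u)
      (f.contMDiff.mdifferentiable (by simp) u) Y.mdifferentiableAt
    rw [add_comm] at h
    exact h

variable (I N) in
/-- The `k`-forms on `N`, as alternating `C^∞(N)`-multilinear maps. -/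
abbrev Form (k : ℕ) : Type _ := VField I N [⋀^Fin k]→ₗ[Fn I N] Fn I N

variable (I N) in
/-- The vector valued `l`-forms on `N`, as alternating `C^∞(N)`-multilinear maps. -/
abbrev VForm (l : ℕ) : Type _ := VField I N [⋀^Fin l]→ₗ[Fn I N] VField I N

variable (I N) in
/-- The `(1,1)`-tensors on `N`. -/
abbrev End : Type _ := VField I N →ₗ[Fn I N] VField I N

theorem exists_extDer {k : ℕ} (α : Form I N k) :
    ∃ η : Form I N (k + 1), ∀ X, η X = koszul lieD α X :=
  exists_form_eq_koszul lieD
    (fun X Y f => by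
      ext u
      exact map_add (mvfderiv I f u) (X u) (Y u))
    (fun f X g => by
      ext u
      exact map_smul (mvfderiv I g u) (f u) (X u))
    (fun X Y Z => by
      ext u
      exact VectorField.mlieBracket_add_left X.mdifferentiableAt Y.mdifferentiableAt)
    (fun X => by
      ext u
      simp [lieD, VField.bracket_apply]) α

/-- The exterior derivative of a `k`-form, given by Koszul's formula. -/
def extDer {k : ℕ} (α : Form I N k) : Form I N (k + 1) where
  toFun X := koszul lieD α X
  map_update_add' := by
    obtain ⟨η, h⟩ := exists_extDer α
    intro inst X i x y
    rw [← h, ← h, ← h, η.map_update_add]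
  map_update_smul' := by
    obtain ⟨η, h⟩ := exists_extDer α
    intro inst X i f x
    rw [← h, ← h, η.map_update_smul]
  map_eq_zero_of_eq' := by
    obtain ⟨η, h⟩ := exists_extDer α
    intro X i j hij hne
    rw [← h, η.map_eq_zero_of_eq X hij hne]

/-- `d_A = i_A d - d i_A` for a `(1,1)`-tensor `A`. -/
def dAlong (A : End I N) {k : ℕ} (α : Form I N k) : Form I N (k + 1) :=
  insertion (ofEnd A) rfl (extDer α) - extDer (insertion (ofEnd A) rfl α)

end Manifold

section SlitTangentBundle

variable {E : Type*} [NormedAddCommGroup E] [NormedSpace ℝ E]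
  {H : Type*} [TopologicalSpace H] (I : ModelWithCorners ℝ E H)
  (M : Type*) [TopologicalSpace M] [ChartedSpace H M] [IsManifold I ∞ M]

lemma isOpen_slit : IsOpen {u : TangentBundle I M | u.snd ≠ 0} := by
  rw [isOpen_iff_mem_nhds]
  intro u hu
  let e := trivializationAt E (TangentSpace I : M → Type _) u.proj
  have hus : u ∈ e.source := e.mem_source.2 (FiberBundle.mem_baseSet_trivializationAt' u.proj)
  have hz : ∀ v : TangentBundle I M, v ∈ e.source → ((e v).2 = 0 ↔ v.snd = 0) := by
    intro v hv
    have hb : v.proj ∈ e.baseSet := e.mem_source.1 hv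
    have h1 : e.continuousLinearEquivAt ℝ v.proj hb v.snd = (e v).2 := rfl
    rw [← h1]
    exact (e.continuousLinearEquivAt ℝ v.proj hb).map_eq_zero_iff
  have hc : ContinuousAt (fun v => (e v).2) u :=
    continuous_snd.continuousAt.comp (e.continuousAt hus)
  have h1 : ∀ᶠ v in nhds u, (e v).2 ≠ 0 :=
    hc.eventually_ne (fun h => hu ((hz u hus).1 h))
  filter_upwards [h1, e.open_source.mem_nhds hus] with v hv hvs h
  exact hv ((hz v hvs).2 h)

/-- The slit tangent bundle `TM ∖ {0}`, an open submanifold of `TM`. -/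
def slit : TopologicalSpace.Opens (TangentBundle I M) := ⟨{u | u.snd ≠ 0}, isOpen_slit I M⟩

/-- `TM ∖ {0}` as a manifold. -/
abbrev Slit : Type _ := slit I M

variable {I M}

/-- The projection `π : TM ∖ {0} → M`. -/
def Slit.proj (u : Slit I M) : M := u.1.proj

/-- The element `u`, as a tangent vector of `M`. -/
def Slit.vec (u : Slit I M) : TangentSpace I u.proj := u.1.snd

open Classical in
/-- `u + w` for a tangent vector `w` of `M` at `π(u)`, with the junk value `u` if `u + w = 0`. -/
def Slit.add (u : Slit I M) (w : TangentSpace I u.proj) : Slit I M :=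
  if h : u.vec + w ≠ 0 then ⟨⟨u.proj, u.vec + w⟩, h⟩ else u

lemma Slit.add_zero (u : Slit I M) : u.add 0 = u := by
  unfold Slit.add
  split_ifs with h
  · apply Subtype.ext
    change (⟨u.1.proj, u.1.snd + 0⟩ : TangentBundle I M) = ⟨u.1.proj, u.1.snd⟩
    rw [_root_.add_zero]
  · rfl

/-- The vertical lift `T_{π(u)}M → T_u(TM ∖ {0})`, `w ↦ (u + tw)'(0)`: the derivative at `0` of
`w ↦ u + w`. -/
def vlift (u : Slit I M) : TangentSpace I u.proj →L[ℝ] TangentSpace I.tangent u :=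
  mfderiv 𝓘(ℝ, E) I.tangent (fun w : E => u.add w) 0

/-- The differential `Dπ : T_u(TM ∖ {0}) → T_{π(u)}M`. -/
def dproj (u : Slit I M) : TangentSpace I.tangent u →L[ℝ] TangentSpace I u.proj :=
  mfderiv I.tangent I Slit.proj u

/-- Smoothness of `(u, t) ↦ u + t w(u)` near `t = 0`. -/
lemma contMDiffAt_add_smul {P : Type*} {E' H' : Type*} [NormedAddCommGroup E'] [NormedSpace ℝ E']
    [TopologicalSpace H'] {I' : ModelWithCorners ℝ E' H'} [TopologicalSpace P] [ChartedSpace H' P]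
    (σ : P → Slit I M) (w : ∀ p, TangentSpace I (σ p).proj) (c : P → ℝ) (p₀ : P)
    (hσ : ContMDiffAt I' I.tangent ∞ σ p₀)
    (hw : ContMDiffAt I' I.tangent ∞ (fun p => (⟨(σ p).proj, w p⟩ : TangentBundle I M)) p₀)
    (hc : ContMDiffAt I' 𝓘(ℝ, ℝ) ∞ c p₀) (h0 : c p₀ • w p₀ = 0) :
    ContMDiffAt I' I.tangent ∞ (fun p => (σ p).add (c p • w p)) p₀ := by
  have hσ' : ContMDiffAt I' I.tangent ∞ (fun p => (σ p).1) p₀ :=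
    (ContMDiffAt.subtypeVal_comp_iff _ _ _).2 hσ
  let F : P → TangentBundle I M := fun p => ⟨(σ p).proj, (σ p).vec + c p • w p⟩
  have hF : ContMDiffAt I' I.tangent ∞ F p₀ := by
    rw [contMDiffAt_totalSpace] at hσ' hw ⊢
    refine ⟨hσ'.1, ?_⟩
    let e := trivializationAt E (TangentSpace I : M → Type _) (σ p₀).proj
    have hs : ContMDiffAt I' 𝓘(ℝ, E) ∞ (fun p => (e (σ p).1).2 + c p • (e ⟨(σ p).proj, w p⟩).2)
        p₀ := hσ'.2.add (hc.smul hw.2)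
    refine hs.congr_of_eventuallyEq ?_
    have hb : ∀ᶠ p in nhds p₀, (σ p).proj ∈ e.baseSet :=
      hσ'.1.continuousAt.eventually_mem
        (e.open_baseSet.mem_nhds (FiberBundle.mem_baseSet_trivializationAt' _))
    filter_upwards [hb] with p hp
    have hl := e.linear ℝ hp
    have h1 := hl.map_add (σ p).vec (c p • w p)
    have h2 := hl.map_smul (c p) (w p)
    rw [h2] at h1
    exact h1
  rw [← ContMDiffAt.subtypeVal_comp_iff]
  refine hF.congr_of_eventuallyEq ?_
  have hne : ∀ᶠ p in nhds p₀, F p ∈ {u : TangentBundle I M | u.snd ≠ 0} := by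
    refine hF.continuousAt.eventually_mem ((isOpen_slit I M).mem_nhds ?_)
    change (σ p₀).vec + c p₀ • w p₀ ≠ 0
    rw [h0, _root_.add_zero]
    exact (σ p₀).2
  filter_upwards [hne] with p hp
  have hp' : (σ p).vec + c p • w p ≠ 0 := hp
  simp only [Function.comp_apply, Slit.add, dif_pos hp']
  rfl

lemma contMDiff_proj : ContMDiff I.tangent I ∞ (Slit.proj : Slit I M → M) :=
  (Bundle.contMDiff_proj (TangentSpace I : M → Type _)).comp contMDiff_subtype_val

lemma contMDiff_dproj (X : VField I.tangent (Slit I M)) :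
    ContMDiff I.tangent I.tangent ∞
      (fun u : Slit I M => (⟨u.proj, dproj u (X u)⟩ : TangentBundle I M)) :=
  (contMDiff_proj.contMDiff_tangentMap (m := ∞) le_rfl).comp X.contMDiff

lemma mdifferentiableAt_add (u : Slit I M) :
    MDifferentiableAt 𝓘(ℝ, E) I.tangent (fun w : E => u.add w) 0 := by
  have hw : ContMDiffAt 𝓘(ℝ, E) I.tangent ∞
      (fun w : E => (⟨u.proj, w⟩ : TangentBundle I M)) 0 := by
    rw [contMDiffAt_totalSpace]
    refine ⟨contMDiffAt_const, ?_⟩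
    let e := trivializationAt E (TangentSpace I : M → Type _) u.proj
    have hb : u.proj ∈ e.baseSet := FiberBundle.mem_baseSet_trivializationAt' _
    let ℓ : E →L[ℝ] E := (e.continuousLinearEquivAt ℝ u.proj hb).toContinuousLinearMap
    exact ℓ.contMDiff.contMDiffAt
  have h := contMDiffAt_add_smul (I' := 𝓘(ℝ, E)) (fun _ : E => u) (fun w => w) (fun _ => (1 : ℝ)) 0
    contMDiffAt_const hw contMDiffAt_const (show (1 : ℝ) • (0 : E) = 0 from smul_zero _)
  have h1 : (fun w : E => u.add (show TangentSpace I u.proj from (1 : ℝ) • w)) =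
      fun w : E => u.add w := by
    funext w; rw [one_smul]
  exact (h1 ▸ h).mdifferentiableAt (by simp)

/-- The vertical lift of `w` is the velocity of the curve `t ↦ u + t w` at `t = 0`. -/
lemma vlift_eq_curve (u : Slit I M) (w : TangentSpace I u.proj) :
    vlift u w = mfderiv 𝓘(ℝ, ℝ) I.tangent (fun t : ℝ => u.add (t • w)) 0 (1 : ℝ) := by
  let ℓ : ℝ →L[ℝ] E := (ContinuousLinearMap.id ℝ ℝ).smulRight (w : E)
  have h := mfderiv_comp (I := 𝓘(ℝ, ℝ)) (I' := 𝓘(ℝ, E)) (I'' := I.tangent) (0 : ℝ)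
    (g := fun w : E => u.add w) (f := ℓ)
    (by rw [map_zero]; exact mdifferentiableAt_add u) ℓ.differentiableAt.mdifferentiableAt
  have h2 := congrArg (fun T => T (1 : ℝ)) h
  have h3 : mfderiv 𝓘(ℝ, ℝ) 𝓘(ℝ, E) ℓ 0 = ℓ := by
    rw [mfderiv_eq_fderiv]; exact ℓ.fderiv
  have h4 : (ℓ 0 : E) = 0 := map_zero _
  have h5 : (ℓ (1 : ℝ) : E) = w := one_smul ℝ (w : E)
  rw [h3, h4] at h2
  have h6 : mfderiv 𝓘(ℝ, ℝ) I.tangent ((fun w : E => u.add w) ∘ ℓ) 0 (1 : ℝ) =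
      vlift u (ℓ (1 : ℝ)) := h2
  rw [h5] at h6
  exact h6.symm

/-- The tangent structure maps smooth vector fields to smooth vector fields. -/
lemma contMDiff_tangentStructure (X : VField I.tangent (Slit I M)) :
    ContMDiff I.tangent I.tangent.tangent ∞
      (fun u : Slit I M => (⟨u, vlift u (dproj u (X u))⟩ : TangentBundle I.tangent (Slit I M))) := by
  intro u₀
  let f : Slit I M → ℝ → Slit I M := fun u t => u.add (t • dproj u (X u))
  have hf : ContMDiffAt (I.tangent.prod 𝓘(ℝ, ℝ)) I.tangent ∞ (Function.uncurry f) (u₀, 0) :=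
    contMDiffAt_add_smul (fun p : Slit I M × ℝ => p.1) (fun p => dproj p.1 (X p.1)) (fun p => p.2)
      (u₀, 0) contMDiffAt_fst ((contMDiff_dproj X).contMDiffAt.comp (u₀, (0 : ℝ)) contMDiffAt_fst)
      contMDiffAt_snd (zero_smul _ _)
  have hid : (fun u : Slit I M => f u 0) = id := by
    funext u
    change u.add ((0 : ℝ) • dproj u (X u)) = u
    rw [zero_smul, Slit.add_zero]
  have key := ContMDiffAt.mfderiv_apply (m := ∞) (n := ∞) (I := 𝓘(ℝ, ℝ)) (J := I.tangent) f
    (fun _ => 0) id (fun _ => (1 : ℝ)) hf contMDiffAt_const contMDiffAt_id contMDiffAt_const le_rfl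
  rw [contMDiffAt_section]
  refine key.congr_of_eventuallyEq ?_
  let e := trivializationAt (E × E) (TangentSpace I.tangent : Slit I M → Type _) u₀
  filter_upwards [e.open_baseSet.mem_nhds (FiberBundle.mem_baseSet_trivializationAt' u₀)] with u hu
  have h1 : vlift u (dproj u (X u)) = mfderiv 𝓘(ℝ, ℝ) I.tangent (f u) 0 (1 : ℝ) :=
    vlift_eq_curve u _
  rw [h1, hid]
  simp only [inTangentCoordinates, ContinuousLinearMap.inCoordinates, id_eq,
    ContinuousLinearMap.comp_apply]
  rw [TangentBundle.symmL_model_space]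
  exact (congrFun (e.coe_linearMapAt_of_mem (R := ℝ) hu) _).symm

variable (I M) in
/-- The tangent structure `J`, `J(ξ) = (u + t Dπ(ξ))'(0)` for `ξ ∈ T_u(TM ∖ {0})`. -/
def tangentStructure : End I.tangent (Slit I M) where
  toFun X := ⟨fun u => vlift u (dproj u (X u)), contMDiff_tangentStructure X⟩
  map_add' X Y := by
    ext u
    change vlift u (dproj u (X u + Y u)) = vlift u (dproj u (X u)) + vlift u (dproj u (Y u))
    rw [map_add, map_add]
  map_smul' f X := by
    ext u
    change vlift u (dproj u (f u • X u)) = f u • vlift u (dproj u (X u))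
    rw [map_smul, map_smul]

/-- The Liouville vector field `ℂ(u) = (u + tu)'(0)`. -/
def liouville (u : Slit I M) : TangentSpace I.tangent u := vlift u u.vec

/-- A semispray on `M` is a vector field `S` on `TM ∖ {0}` with `JS = ℂ`. -/
def IsSemispray (S : VField I.tangent (Slit I M)) : Prop :=
  ∀ u, tangentStructure I M S u = liouville u

variable [CompleteSpace E]

section Semispray

variable (S : VField I.tangent (Slit I M))

/-- The almost product structure `Γ = -ℒ_S J`. -/
def almostProduct : End I.tangent (Slit I M) := -(lieD S).onEnd (tangentStructure I M)

/-- The horizontal projector `h = (Id - ℒ_S J) / 2`. -/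
def horProj : End I.tangent (Slit I M) :=
  (1 / 2 : ℝ) • (LinearMap.id - (lieD S).onEnd (tangentStructure I M))

/-- The vertical projector `v = (Id + ℒ_S J) / 2`. -/
def verProj : End I.tangent (Slit I M) :=
  (1 / 2 : ℝ) • (LinearMap.id + (lieD S).onEnd (tangentStructure I M))

/-- The almost complex structure `𝔽 = h ∘ ℒ_S h - J`. -/
def almostComplex : End I.tangent (Slit I M) :=
  horProj S ∘ₗ (lieD S).onEnd (horProj S) - tangentStructure I M

/-- The tensor `Ψ = h ∘ ℒ_S h + v ∘ ℒ_S v`. -/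
def Psi : End I.tangent (Slit I M) :=
  horProj S ∘ₗ (lieD S).onEnd (horProj S) + verProj S ∘ₗ (lieD S).onEnd (verProj S)

/-- `D` is a dynamical covariant derivative of `S`: it is `S` on functions and
`X ↦ h[S, hX] + v[S, vX]` on vector fields. -/
def IsDynCovDeriv (D : TensorDerivation (Fn I.tangent (Slit I M)) (VField I.tangent (Slit I M))) :
    Prop :=
  (∀ f, D.fn f = S.apply f) ∧
    ∀ X, D.vf X = horProj S (S.bracket (horProj S X)) + verProj S (S.bracket (verProj S X))

/-- The derivation `∇ = ℒ_S + Ψ`: it is `S` on functions and `X ↦ [S, X] + ΨX` on vector fields. -/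
def dynCovDeriv : TensorDerivation (Fn I.tangent (Slit I M)) (VField I.tangent (Slit I M)) :=
  (lieD S).addEnd (Psi S)

end Semispray

end SlitTangentBundle

end TensorCalculus

end

open TensorCalculus

/-! The proof rests on two facts. The vertical vectors, the kernel of `Dπ`, are exactly the vertical
lifts, so a field is vertical iff `J` kills it (`exists_vlift_eq`, `tangentStructure_eq_zero_iff`).
And `J[S, X] = -X` for vertical `X` (`IsSemispray.tangentStructure_bracket`), seen by testing `[S,
X]` on functions `f ∘ π`: `X` kills them, and `S` turns them into the fibrewise linear functions
`df`.

Consequently `ℒ_S J` is an involution that is the identity on vertical fields, so `h` and `v` are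
complementary projectors and `v` projects onto the vertical fields. Since `h + v = Id`, the field
`[S, X] + ΨX` collapses to `h[S, hX] + v[S, vX]`, which visibly commutes with `h` and `v`. The
identity `[S, JX] = J[S, hX] - hX` gives `∇J = 0`. Finally `𝔽h = -J` and `𝔽J = h`, and every field
has the form `hX + JY`, so `∇𝔽 = 0` follows from `∇h = 0` and `∇J = 0`.

On forms `∇ = ℒ_S - i_Ψ` (`TensorDerivation.onForm_addEnd`). As `ℒ_S` commutes with `d`
(`extDer_onForm_lieD`, by induction on the degree through Cartan's formula), what remains of `d∇ -
∇d` is `i_Ψ d - d i_Ψ`. The rule `∇ i_A - i_A ∇ = i_{∇A}` is pure algebra, valid for every tensor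
derivation: it holds before alternation (`TensorDerivation.insertFront_leibniz`) and survives it. -/

open TensorCalculus

noncomputable section

namespace TensorCalculus

/-! ### Tangent vectors as derivations, and the Lie bracket. -/

section Manifold

variable {E : Type*} [NormedAddCommGroup E] [NormedSpace ℝ E]
  {H : Type*} [TopologicalSpace H] {I : ModelWithCorners ℝ E H}
  {N : Type*} [TopologicalSpace N] [ChartedSpace H N] [IsManifold I ∞ N]

/-- The differentials of smooth functions separate tangent vectors. -/
lemma eq_zero_of_forall_mvfderiv_eq_zero [FiniteDimensional ℝ E] [T2Space N] {p : N}
    {w : TangentSpace I p} (h : ∀ f : Fn I N, mvfderiv I f p w = 0) : w = 0 := by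
  have hchart := isInvertible_mfderiv_extChartAt (I := I) (mem_extChartAt_source (I := I) p)
  obtain ⟨e, he⟩ := hchart
  have hinj : mfderiv I 𝓘(ℝ, E) (extChartAt I p) p w = 0 → w = 0 := by
    rw [← he]; exact e.map_eq_zero_iff.1
  apply hinj
  obtain ⟨b⟩ : Nonempty (SmoothBumpFunction I p) := inferInstance
  have hmd : MDifferentiableAt I 𝓘(ℝ, E) (extChartAt I p) p :=
    mdifferentiableAt_extChartAt (mem_chart_source H p)
  refine (SeparatingDual.eq_zero_iff_forall_dual_eq_zero (R := ℝ) (V := E) _).2 fun φ => ?_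
  have hsm : ContMDiffOn I 𝓘(ℝ, ℝ) ∞ (φ ∘ extChartAt I p) (chartAt H p).source :=
    φ.contMDiff.comp_contMDiffOn (contMDiffOn_extChartAt (n := ∞))
  -- The coordinate function is smooth only on the chart domain. The bump function, equal to `1`
  -- near `p`, makes it global without changing its differential at `p`.
  let f : Fn I N := ⟨fun x => b x • (φ ∘ extChartAt I p) x, b.contMDiff_smul hsm⟩
  have hf : (f : N → ℝ) =ᶠ[nhds p] φ ∘ extChartAt I p := by
    filter_upwards [b.eventuallyEq_one] with x hx
    change b x • (φ ∘ extChartAt I p) x = _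
    rw [hx]; simp
  have h1 : mfderiv I 𝓘(ℝ, ℝ) f p w = 0 := h f
  rw [hf.mfderiv_eq, mfderiv_comp p φ.differentiableAt.mdifferentiableAt hmd,
    mfderiv_eq_fderiv, φ.fderiv] at h1
  exact h1

lemma VField.bracket_jacobi [CompleteSpace E] (X Y W : VField I N) :
    X.bracket (Y.bracket W) = (X.bracket Y).bracket W + Y.bracket (X.bracket W) := by
  have : IsManifold I (minSmoothness ℝ 3) N := by
    rw [minSmoothness_of_isRCLikeNormedField]; infer_instance
  have hs : ∀ V : VField I N, ContMDiff I I.tangent (minSmoothness ℝ 2)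
      (fun p => (⟨p, V p⟩ : TangentBundle I N)) := by
    intro V
    rw [minSmoothness_of_isRCLikeNormedField]
    exact V.contMDiff.of_le ENat.LEInfty.out
  ext u
  exact VectorField.leibniz_identity_mlieBracket_apply (hs X u) (hs Y u) (hs W u)

/-- Expanding the Jacobi identity for `X`, `Y`, `f • Z` by the Leibniz rule leaves this relation
once the mixed terms cancel. The factor `Z` can be removed wherever `Z` does not vanish. -/
lemma VField.apply_bracket_smul [CompleteSpace E] (X Y Z : VField I N) (f : Fn I N) :
    (X.bracket Y).apply f • Z = (X.apply (Y.apply f) - Y.apply (X.apply f)) • Z := by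
  have jac := VField.bracket_jacobi X Y
  have l : ∀ (X : VField I N) f W, X.bracket (f • W) = f • X.bracket W + X.apply f • W :=
    fun X => (lieD X).leibniz
  have a : ∀ (X V W : VField I N), X.bracket (V + W) = X.bracket V + X.bracket W :=
    fun X => (lieD X).vf.map_add
  have h := jac (f • Z)
  simp only [l, a, jac, smul_add] at h
  rw [sub_smul, eq_sub_iff_add_eq]
  have h' := sub_eq_zero.2 h
  rw [← sub_eq_zero, ← neg_eq_zero, ← h']
  abel

end Manifold

/-! ### The vertical distribution of the slit tangent bundle. -/

section SlitTangentBundle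

variable {E : Type*} [NormedAddCommGroup E] [NormedSpace ℝ E]
  {H : Type*} [TopologicalSpace H] {I : ModelWithCorners ℝ E H}
  {M : Type*} [TopologicalSpace M] [ChartedSpace H M] [IsManifold I ∞ M]

lemma mdifferentiableAt_slitProj (u : Slit I M) :
    MDifferentiableAt I.tangent I Slit.proj u :=
  contMDiff_proj.contMDiffAt.mdifferentiableAt (by simp)

lemma dproj_vlift (u : Slit I M) (w : TangentSpace I u.proj) : dproj u (vlift u w) = 0 := by
  have h := mfderiv_comp_apply_of_eq (I := 𝓘(ℝ, E)) (0 : E) (mdifferentiableAt_slitProj u)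
    (mdifferentiableAt_add u) u.add_zero w
  have hc : (Slit.proj ∘ fun w : E => u.add w) = fun _ => u.proj := by
    funext w
    simp only [Function.comp, Slit.add]
    -- Both branches of `Slit.add`, the junk value included, lie in the fibre of `u`.
    split_ifs <;> rfl
  rw [hc, mfderiv_const] at h
  exact h.symm

/-- The pullback of a function to the slit tangent bundle. -/
def pullbackFn (f : Fn I M) : Fn I.tangent (Slit I M) :=
  ⟨fun u => f u.proj, f.contMDiff.comp contMDiff_proj⟩

lemma mvfderiv_pullbackFn (f : Fn I M) (u : Slit I M) (ξ : TangentSpace I.tangent u) :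
    mvfderiv I.tangent (pullbackFn f) u ξ = mvfderiv I f u.proj (dproj u ξ) :=
  mvfderiv_comp_apply u (f.contMDiff.mdifferentiable (by simp) _) (mdifferentiableAt_slitProj u) ξ

/-- The differential of a function on `M`, as a fibrewise linear function on the slit tangent
bundle. -/
def differentialFn (f : Fn I M) : Fn I.tangent (Slit I M) :=
  ⟨fun u => mvfderiv I f u.proj u.vec, by
    have h := (f.contMDiff.contMDiff_tangentMap (m := ∞) le_rfl).comp
      (contMDiff_subtype_val (U := slit I M) (I := I.tangent) (n := ∞))
    exact (contMDiff_snd_tangentBundle_modelSpace _ _).comp h⟩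

/-- On the fibre through `u` the function is affine near `w = 0`, with linear part `df`. Since `u`
is nonzero, so is `u + w` for small `w`, and the junk value of `Slit.add` plays no role. -/
lemma mvfderiv_differentialFn_vlift (f : Fn I M) (u : Slit I M) (w : TangentSpace I u.proj) :
    mvfderiv I.tangent (differentialFn f) u (vlift u w) = mvfderiv I f u.proj w := by
  have h := mvfderiv_comp_apply_of_eq (I := I.tangent) (I' := 𝓘(ℝ, E)) (0 : E)
    ((differentialFn f).contMDiff.mdifferentiable (by simp) u)
    (mdifferentiableAt_add u) u.add_zero w
  refine Eq.trans h.symm ?_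
  let ℓ : E →L[ℝ] ℝ := mvfderiv I f u.proj
  have hc : (differentialFn f ∘ fun w : E => u.add w) =ᶠ[nhds 0]
      fun w : E => ℓ u.vec + ℓ w := by
    let z : E := u.vec
    have hc : ContinuousAt (fun w : E => z + w) 0 := by fun_prop
    have hne : ∀ᶠ w : E in nhds 0, z + w ≠ 0 := by
      refine hc.eventually_ne ?_
      rw [add_zero]; exact u.2
    filter_upwards [hne] with w hw
    have hw' : u.vec + (show TangentSpace I u.proj from w) ≠ 0 := hw
    simp only [Function.comp, Slit.add]
    rw [dif_pos hw']
    exact ℓ.map_add _ _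
  have h2 : HasFDerivAt (fun w : E => ℓ u.vec + ℓ w) ℓ 0 := ℓ.hasFDerivAt.const_add _
  unfold mvfderiv
  rw [hc.mfderiv_eq, mfderiv_eq_fderiv, h2.fderiv]
  rfl

/-- The fibrewise linear functions `df` recover every `df(w)` from the lift of `w`, and these
numbers determine `w`. -/
lemma vlift_injective [FiniteDimensional ℝ E] [T2Space M] (u : Slit I M) :
    Function.Injective (vlift u) := by
  refine (injective_iff_map_eq_zero _).2 fun w hw => ?_
  refine eq_zero_of_forall_mvfderiv_eq_zero fun f => ?_
  rw [← mvfderiv_differentialFn_vlift, hw, map_zero]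

/-- A local section of `π` through `u` provides a right inverse of `Dπ` at `u`. -/
lemma dproj_surjective (u : Slit I M) : Function.Surjective (dproj u) := by
  classical
  let s : M → TangentBundle I M := fun p => ⟨p, FiberBundle.extend E u.vec p⟩
  have hs : ContMDiffAt I I.tangent ∞ s u.proj := FiberBundle.contMDiffAt_extend I E u.vec
  have hsu : s u.proj = u.1 := by
    change (⟨u.proj, FiberBundle.extend E u.vec u.proj⟩ : TangentBundle I M) = ⟨u.proj, u.vec⟩
    rw [FiberBundle.extend_apply_self]
  -- Where the extension of `u.vec` vanishes, the constant `u` is used instead. Only the germ at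
  -- `π(u)` matters, and there the extension is nonzero.
  let s' : M → Slit I M := fun p => if h : s p ∈ slit I M then ⟨s p, h⟩ else u
  have hmem : ∀ᶠ p in nhds u.proj, s p ∈ slit I M :=
    hs.continuousAt.eventually_mem ((slit I M).isOpen.mem_nhds (by rw [hsu]; exact u.2))
  have hs'u : s' u.proj = u := by
    simp only [s', hsu]
    exact dif_pos u.2
  have hs' : ContMDiffAt I I.tangent ∞ s' u.proj := by
    rw [← ContMDiffAt.subtypeVal_comp_iff]
    refine hs.congr_of_eventuallyEq ?_
    filter_upwards [hmem] with p hp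
    simp only [Function.comp_apply, s', dif_pos hp]
  have hc : (Slit.proj ∘ s') =ᶠ[nhds u.proj] id := by
    filter_upwards [hmem] with p hp
    simp only [Function.comp_apply, s', dif_pos hp]
    rfl
  intro w
  have h := mfderiv_comp_apply_of_eq u.proj (mdifferentiableAt_slitProj u)
    (hs'.mdifferentiableAt (by simp)) hs'u w
  rw [hc.mfderiv_eq, mfderiv_id] at h
  exact ⟨mfderiv I I.tangent s' u.proj w, h.symm⟩

/-- Dimension count: the lifts lie in the kernel of `Dπ`. They form a space of dimension `dim E` by
injectivity, and the kernel has dimension `2 dim E - dim E` by surjectivity. -/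
lemma exists_vlift_eq [FiniteDimensional ℝ E] [T2Space M] {u : Slit I M}
    {ξ : TangentSpace I.tangent u} (h : dproj u ξ = 0) : ∃ w, vlift u w = ξ := by
  let P : E × E →ₗ[ℝ] E := (dproj u).toLinearMap
  let L : E →ₗ[ℝ] E × E := (vlift u).toLinearMap
  have hle : L.range ≤ P.ker := by
    rintro _ ⟨w, rfl⟩
    exact dproj_vlift u w
  have h1 : Module.finrank ℝ L.range = Module.finrank ℝ E :=
    LinearMap.finrank_range_of_inj (vlift_injective u)
  have h2 := P.finrank_range_add_finrank_ker
  have h5 : P.range = ⊤ := LinearMap.range_eq_top.2 (dproj_surjective u)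
  rw [h5, finrank_top, Module.finrank_prod] at h2
  have h3 : L.range = P.ker := Submodule.eq_of_le_of_finrank_eq hle (by omega)
  have h4 : (ξ : E × E) ∈ P.ker := h
  rw [← h3] at h4
  exact h4

lemma tangentStructure_eq_zero_iff [FiniteDimensional ℝ E] [T2Space M]
    (X : VField I.tangent (Slit I M)) :
    tangentStructure I M X = 0 ↔ ∀ u, dproj u (X u) = 0 := by
  refine ⟨fun h u => ?_, fun h => ?_⟩
  · have h' : vlift u (dproj u (X u)) = 0 := congrArg (fun Y : VField I.tangent (Slit I M) => Y u) h
    exact (map_eq_zero_iff _ (vlift_injective u)).1 h'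
  · ext u
    change vlift u (dproj u (X u)) = 0
    rw [h, map_zero]

lemma tangentStructure_sq (X : VField I.tangent (Slit I M)) :
    tangentStructure I M (tangentStructure I M X) = 0 := by
  ext u
  change vlift u (dproj u (vlift u (dproj u (X u)))) = 0
  rw [dproj_vlift, map_zero]

/-! ### Brackets with a semispray. -/

section Semispray

variable [FiniteDimensional ℝ E] [T2Space M] {S : VField I.tangent (Slit I M)}

lemma IsSemispray.dproj_eq (hS : IsSemispray S) (u : Slit I M) : dproj u (S u) = u.vec :=
  vlift_injective u (hS u)

/-- A semispray vanishes nowhere because `Dπ(S(u)) = u ≠ 0`, so it can be cancelled from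
`VField.apply_bracket_smul` with `Z = S`. -/
lemma IsSemispray.apply_bracket [CompleteSpace E] (hS : IsSemispray S)
    (X Y : VField I.tangent (Slit I M)) (f : Fn I.tangent (Slit I M)) :
    (X.bracket Y).apply f = X.apply (Y.apply f) - Y.apply (X.apply f) := by
  ext u
  have hu : S u ≠ 0 := fun h => u.2 <| by
    have := hS.dproj_eq u
    rw [h, map_zero] at this
    exact this.symm
  have h := congrArg (fun Z : VField I.tangent (Slit I M) => Z u)
    (VField.apply_bracket_smul X Y S f)
  exact smul_left_injective ℝ hu h

/-- If `X` is vertical, then `J[S, X] = -X`. -/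
lemma IsSemispray.tangentStructure_bracket [CompleteSpace E] (hS : IsSemispray S)
    {X : VField I.tangent (Slit I M)} (hX : tangentStructure I M X = 0) :
    tangentStructure I M (S.bracket X) = -X := by
  rw [tangentStructure_eq_zero_iff] at hX
  ext u
  obtain ⟨w, hw⟩ := exists_vlift_eq (hX u)
  -- Tested on `f ∘ π`: since `X(f ∘ π) = 0` and `S(f ∘ π) = df`, the bracket gives `-X(df)`, which
  -- at `u` is `-df(w)` when `X(u)` is the lift of `w`.
  have key : dproj u (S.bracket X u) = -w := by
    rw [← sub_eq_zero, sub_neg_eq_add]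
    refine eq_zero_of_forall_mvfderiv_eq_zero fun f => ?_
    have hXf : X.apply (pullbackFn f) = 0 := by
      ext u
      rw [VField.apply_apply, mvfderiv_pullbackFn, hX, map_zero]
      rfl
    have hSf : S.apply (pullbackFn f) = differentialFn f := by
      ext u
      rw [VField.apply_apply, mvfderiv_pullbackFn, hS.dproj_eq]
      rfl
    have h := hS.apply_bracket S X (pullbackFn f)
    have h0 : S.apply 0 = 0 := S.derivation.map_zero
    rw [hXf, hSf, h0, zero_sub] at h
    have h' := congrArg (fun g : Fn I.tangent (Slit I M) => g u) h
    change mvfderiv I.tangent (pullbackFn f) u (S.bracket X u) =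
      -(mvfderiv I.tangent (differentialFn f) u (X u)) at h'
    rw [mvfderiv_pullbackFn, ← hw, mvfderiv_differentialFn_vlift] at h'
    rw [map_add, h', neg_add_cancel]
  change vlift u (dproj u (S.bracket X u)) = -(X u)
  rw [key, map_neg, hw]

end Semispray

end SlitTangentBundle

/-! ### The projectors `h` and `v`, and the parallel tensors of `∇`. -/

section SlitTangentBundle

variable {E : Type*} [NormedAddCommGroup E] [NormedSpace ℝ E]
  {H : Type*} [TopologicalSpace H] {I : ModelWithCorners ℝ E H}
  {M : Type*} [TopologicalSpace M] [ChartedSpace H M] [IsManifold I ∞ M]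
  [CompleteSpace E] {S : VField I.tangent (Slit I M)}

lemma VField.bracket_zero (X : VField I.tangent (Slit I M)) : X.bracket 0 = 0 :=
  (lieD X).vf.map_zero

lemma onEnd_lieD_apply (A : End I.tangent (Slit I M)) (X : VField I.tangent (Slit I M)) :
    (lieD S).onEnd A X = S.bracket (A X) - A (S.bracket X) := rfl

lemma horProj_apply (X : VField I.tangent (Slit I M)) :
    horProj S X = (1 / 2 : ℝ) • (X - (lieD S).onEnd (tangentStructure I M) X) := rfl

lemma verProj_apply (X : VField I.tangent (Slit I M)) :
    verProj S X = (1 / 2 : ℝ) • (X + (lieD S).onEnd (tangentStructure I M) X) := rfl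

lemma horProj_add_verProj (X : VField I.tangent (Slit I M)) : horProj S X + verProj S X = X := by
  rw [horProj_apply, verProj_apply]
  module

lemma almostProduct_eq : almostProduct S = horProj S - verProj S := by
  ext1 X
  change -((lieD S).onEnd (tangentStructure I M) X) = horProj S X - verProj S X
  rw [horProj_apply, verProj_apply]
  module

namespace IsSemispray

variable [FiniteDimensional ℝ E] [T2Space M] {X : VField I.tangent (Slit I M)}

lemma tangentStructure_bracket_tangentStructure (hS : IsSemispray S) :
    tangentStructure I M (S.bracket (tangentStructure I M X)) = -tangentStructure I M X :=
  hS.tangentStructure_bracket (tangentStructure_sq X)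

lemma onEnd_of_vertical (hS : IsSemispray S) (hX : tangentStructure I M X = 0) :
    (lieD S).onEnd (tangentStructure I M) X = X := by
  rw [onEnd_lieD_apply, hX, hS.tangentStructure_bracket hX, VField.bracket_zero, zero_sub, neg_neg]

lemma tangentStructure_onEnd (hS : IsSemispray S) :
    tangentStructure I M ((lieD S).onEnd (tangentStructure I M) X) = -tangentStructure I M X := by
  rw [onEnd_lieD_apply, map_sub, hS.tangentStructure_bracket_tangentStructure,
    tangentStructure_sq, sub_zero]

/-- The field `(ℒ_S J)X + X` is killed by `J`, hence fixed by `ℒ_S J`. Cancelling `(ℒ_S J)X` leaves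
the claim. -/
lemma onEnd_onEnd (hS : IsSemispray S) : (lieD S).onEnd (tangentStructure I M)
    ((lieD S).onEnd (tangentStructure I M) X) = X := by
  have h := hS.onEnd_of_vertical (X := (lieD S).onEnd (tangentStructure I M) X + X) (by
    rw [map_add, hS.tangentStructure_onEnd, neg_add_cancel])
  rw [map_add, add_comm] at h
  exact add_left_cancel h

lemma verProj_of_vertical (hS : IsSemispray S) (hX : tangentStructure I M X = 0) :
    verProj S X = X := by
  rw [verProj_apply, hS.onEnd_of_vertical hX]
  module

lemma horProj_of_vertical (hS : IsSemispray S) (hX : tangentStructure I M X = 0) :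
    horProj S X = 0 := by
  rw [horProj_apply, hS.onEnd_of_vertical hX, sub_self, smul_zero]

lemma tangentStructure_verProj (hS : IsSemispray S) :
    tangentStructure I M (verProj S X) = 0 := by
  rw [verProj_apply, LinearMap.map_smul_of_tower, map_add, hS.tangentStructure_onEnd,
    add_neg_cancel, smul_zero]

lemma tangentStructure_horProj (hS : IsSemispray S) :
    tangentStructure I M (horProj S X) = tangentStructure I M X := by
  conv_rhs => rw [← horProj_add_verProj (S := S) X, map_add, hS.tangentStructure_verProj, add_zero]

/-- `v` takes vertical values and fixes vertical fields. The other projector relations follow from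
this and `h + v = Id`. -/
lemma verProj_verProj (hS : IsSemispray S) : verProj S (verProj S X) = verProj S X :=
  hS.verProj_of_vertical hS.tangentStructure_verProj

lemma horProj_verProj (hS : IsSemispray S) : horProj S (verProj S X) = 0 :=
  hS.horProj_of_vertical hS.tangentStructure_verProj

lemma horProj_horProj (hS : IsSemispray S) : horProj S (horProj S X) = horProj S X := by
  have h := congrArg (horProj S) (horProj_add_verProj (S := S) X)
  rwa [map_add, hS.horProj_verProj, add_zero] at h

lemma verProj_horProj (hS : IsSemispray S) : verProj S (horProj S X) = 0 := by
  have h := horProj_add_verProj (S := S) (horProj S X)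
  rwa [hS.horProj_horProj, add_eq_left] at h

lemma horProj_tangentStructure (hS : IsSemispray S) :
    horProj S (tangentStructure I M X) = 0 :=
  hS.horProj_of_vertical (tangentStructure_sq X)

lemma verProj_tangentStructure (hS : IsSemispray S) :
    verProj S (tangentStructure I M X) = tangentStructure I M X :=
  hS.verProj_of_vertical (tangentStructure_sq X)

/-- Idempotence turns `ΨX` into `h[S, hX] + v[S, vX] - (h + v)[S, X]`, and the last term cancels
`[S, X]`. -/
lemma dynCovDeriv_vf (hS : IsSemispray S) (X : VField I.tangent (Slit I M)) :
    (dynCovDeriv S).vf X =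
      horProj S (S.bracket (horProj S X)) + verProj S (S.bracket (verProj S X)) := by
  change S.bracket X + (horProj S (S.bracket (horProj S X) - horProj S (S.bracket X)) +
    verProj S (S.bracket (verProj S X) - verProj S (S.bracket X))) = _
  rw [map_sub, map_sub, hS.horProj_horProj, hS.verProj_verProj]
  nth_rewrite 1 [← horProj_add_verProj (S := S) (S.bracket X)]
  abel

lemma isDynCovDeriv_iff (hS : IsSemispray S)
    (D : TensorDerivation (Fn I.tangent (Slit I M)) (VField I.tangent (Slit I M))) :
    IsDynCovDeriv S D ↔ D = dynCovDeriv S := by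
  constructor
  · rintro ⟨hf, hX⟩
    obtain ⟨fn, vf, leib⟩ := D
    have h1 : fn = (dynCovDeriv S).fn := by
      ext1 f; exact hf f
    have h2 : vf = (dynCovDeriv S).vf := by
      ext1 X; rw [hS.dynCovDeriv_vf]; exact hX X
    subst h1 h2
    rfl
  · rintro rfl
    exact ⟨fun f => rfl, hS.dynCovDeriv_vf⟩

lemma dynCovDeriv_horProj (hS : IsSemispray S) :
    (dynCovDeriv S).vf (horProj S X) = horProj S ((dynCovDeriv S).vf X) := by
  rw [hS.dynCovDeriv_vf, hS.dynCovDeriv_vf, hS.horProj_horProj, hS.verProj_horProj, VField.bracket_zero,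
    map_zero, map_add, hS.horProj_horProj, hS.horProj_verProj]

lemma dynCovDeriv_verProj (hS : IsSemispray S) :
    (dynCovDeriv S).vf (verProj S X) = verProj S ((dynCovDeriv S).vf X) := by
  rw [hS.dynCovDeriv_vf, hS.dynCovDeriv_vf, hS.verProj_verProj, hS.horProj_verProj, VField.bracket_zero,
    map_zero, map_add, hS.verProj_verProj, hS.verProj_horProj]

lemma tangentStructure_dynCovDeriv (hS : IsSemispray S) (hX : tangentStructure I M X = 0) :
    tangentStructure I M ((dynCovDeriv S).vf X) = 0 := by
  rw [← hS.verProj_of_vertical hX, hS.dynCovDeriv_verProj, hS.tangentStructure_verProj]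

/-- `[S, JX] = J[S, hX] - hX`. -/
lemma bracket_tangentStructure (hS : IsSemispray S) :
    S.bracket (tangentStructure I M X) =
      tangentStructure I M (S.bracket (horProj S X)) - horProj S X := by
  -- The involution `ℒ_S J` is `-1` on the image of `h = (Id - ℒ_S J) / 2`.
  have h1 : (lieD S).onEnd (tangentStructure I M) (horProj S X) = -horProj S X := by
    rw [horProj_apply, LinearMap.map_smul_of_tower, map_sub, hS.onEnd_onEnd]
    module
  rw [onEnd_lieD_apply, hS.tangentStructure_horProj, sub_eq_iff_eq_add] at h1
  rw [h1]
  abel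

/-- Both sides equal `J[S, hX]`. On the left, `JX` is vertical and `v` removes the term `-hX` of
`bracket_tangentStructure`; on the right, `J` kills the vertical part of `∇X` and does not see the
projector `h`. -/
lemma dynCovDeriv_tangentStructure (hS : IsSemispray S) :
    (dynCovDeriv S).vf (tangentStructure I M X) =
      tangentStructure I M ((dynCovDeriv S).vf X) := by
  rw [hS.dynCovDeriv_vf, hS.dynCovDeriv_vf, hS.verProj_tangentStructure, hS.horProj_tangentStructure,
    VField.bracket_zero, map_zero, zero_add, hS.bracket_tangentStructure, map_sub,
    hS.verProj_horProj, sub_zero, hS.verProj_tangentStructure, map_add, hS.tangentStructure_horProj,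
    hS.tangentStructure_verProj, add_zero]

lemma almostComplex_horProj (hS : IsSemispray S) :
    almostComplex S (horProj S X) = -tangentStructure I M X := by
  change horProj S (S.bracket (horProj S (horProj S X)) - horProj S (S.bracket (horProj S X))) -
    tangentStructure I M (horProj S X) = _
  rw [hS.horProj_horProj, map_sub, hS.horProj_horProj, sub_self, hS.tangentStructure_horProj,
    zero_sub]

lemma almostComplex_tangentStructure (hS : IsSemispray S) :
    almostComplex S (tangentStructure I M X) = horProj S X := by
  change horProj S (S.bracket (horProj S (tangentStructure I M X)) -
    horProj S (S.bracket (tangentStructure I M X))) -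
      tangentStructure I M (tangentStructure I M X) = _
  rw [hS.horProj_tangentStructure, VField.bracket_zero, zero_sub, map_neg, hS.horProj_horProj,
    tangentStructure_sq, sub_zero, hS.bracket_tangentStructure, map_sub,
    hS.horProj_tangentStructure, hS.horProj_horProj, zero_sub, neg_neg]

/-- The explicit preimage `-[S, X]` is a global smooth field, so nothing has to be glued. -/
lemma exists_tangentStructure_eq (hS : IsSemispray S) (hX : tangentStructure I M X = 0) :
    ∃ Y, tangentStructure I M Y = X :=
  ⟨-S.bracket X, by rw [map_neg, hS.tangentStructure_bracket hX, neg_neg]⟩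

/-- Writing `vX = JY` splits the field as `hX + JY`; `𝔽` sends `hX` to `-JX` and `JY` to `hY`, and
`∇` commutes with `h` and `J`. -/
lemma dynCovDeriv_almostComplex (hS : IsSemispray S) :
    (dynCovDeriv S).vf (almostComplex S X) = almostComplex S ((dynCovDeriv S).vf X) := by
  obtain ⟨Y, hY⟩ := hS.exists_tangentStructure_eq (hS.tangentStructure_verProj (X := X))
  rw [← horProj_add_verProj (S := S) X, ← hY]
  simp only [map_add, hS.almostComplex_horProj, hS.almostComplex_tangentStructure, map_neg,
    hS.dynCovDeriv_horProj, hS.dynCovDeriv_tangentStructure]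

lemma onEnd_horProj (hS : IsSemispray S) : (dynCovDeriv S).onEnd (horProj S) = 0 :=
  LinearMap.ext fun _ => sub_eq_zero.2 hS.dynCovDeriv_horProj

lemma onEnd_verProj (hS : IsSemispray S) : (dynCovDeriv S).onEnd (verProj S) = 0 :=
  LinearMap.ext fun _ => sub_eq_zero.2 hS.dynCovDeriv_verProj

lemma onEnd_tangentStructure (hS : IsSemispray S) :
    (dynCovDeriv S).onEnd (tangentStructure I M) = 0 :=
  LinearMap.ext fun _ => sub_eq_zero.2 hS.dynCovDeriv_tangentStructure

lemma onEnd_almostComplex (hS : IsSemispray S) : (dynCovDeriv S).onEnd (almostComplex S) = 0 :=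
  LinearMap.ext fun _ => sub_eq_zero.2 hS.dynCovDeriv_almostComplex

lemma onEnd_almostProduct (hS : IsSemispray S) : (dynCovDeriv S).onEnd (almostProduct S) = 0 := by
  rw [almostProduct_eq]
  refine LinearMap.ext fun X => sub_eq_zero.2 ?_
  rw [LinearMap.sub_apply, LinearMap.sub_apply, map_sub, hS.dynCovDeriv_horProj,
    hS.dynCovDeriv_verProj]

end IsSemispray

end SlitTangentBundle

/-! ### The algebra of insertions, tensor derivations and Koszul's operator. -/

section Algebra

variable {R V : Type*} [CommRing R] [Algebra ℝ R] [AddCommGroup V] [Module R V]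

lemma insertion_zero {k l m : ℕ} (h : m + 1 = k + l) (α : V [⋀^Fin k]→ₗ[R] R) :
    insertion (0 : V [⋀^Fin l]→ₗ[R] V) h α = 0 := by
  cases k with
  | zero => rfl
  | succ k =>
    ext X
    have h0 : ∀ Y : Fin k → V, α (Fin.cons 0 Y) = 0 := fun Y => α.map_coord_zero 0 rfl
    simp [insertion_apply, h0]

/-- The summand of `σ` depends only on `σ 0`, and each value of `σ 0` is taken by `k!` permutations,
which the normalizing factor cancels. -/
lemma insertion_ofEnd_apply {k : ℕ} (A : V →ₗ[R] V) (α : V [⋀^Fin k]→ₗ[R] R) (X : Fin k → V) :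
    insertion (ofEnd A) rfl α X = ∑ i, α (Function.update X i (A (X i))) := by
  cases k with
  | zero => rfl
  | succ k =>
    have hterm : ∀ σ : Equiv.Perm (Fin (k + 1)), Equiv.Perm.sign σ •
        α (Fin.cons (ofEnd A fun i : Fin 1 => X (σ ⟨i, by omega⟩))
          fun j : Fin k => X (σ ⟨1 + j, by omega⟩)) =
        α (Function.update X (σ 0) (A (X (σ 0)))) := by
      intro σ
      -- The arguments are `X` with `A` applied in slot `σ 0`, permuted by `σ`; undoing the
      -- permutation produces a second `sign σ`, so the signs cancel.
      have h1 : (Fin.cons (ofEnd A fun i : Fin 1 => X (σ ⟨i, by omega⟩))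
          fun j : Fin k => X (σ ⟨1 + j, by omega⟩) : Fin (k + 1) → V) =
          Function.update X (σ 0) (A (X (σ 0))) ∘ σ := by
        rw [Function.update_comp_eq_of_injective X σ.injective]
        funext j
        refine Fin.cases ?_ (fun j => ?_) j
        · simp [ofEnd]
        · rw [Function.update_of_ne (Fin.succ_ne_zero j), Fin.cons_succ]
          simp only [Function.comp]
          congr 2
          ext
          simp [add_comm]
      rw [h1, α.map_perm, smul_smul, Int.units_mul_self, one_smul]
    rw [insertion_apply]
    simp only [hterm]
    rw [← Equiv.sum_comp Equiv.Perm.decomposeFin.symm, Fintype.sum_prod_type]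
    simp only [Equiv.Perm.decomposeFin_symm_apply_zero, Finset.sum_const, Finset.card_univ,
      Fintype.card_perm, Fintype.card_fin, ← Finset.smul_sum]
    rw [← Nat.cast_smul_eq_nsmul ℝ, smul_smul, Nat.factorial_one, Nat.cast_one, one_mul,
      inv_mul_cancel₀ (Nat.cast_ne_zero.2 k.factorial_ne_zero), one_smul]

variable [Module ℝ V]

namespace TensorDerivation

lemma onForm_apply (D : TensorDerivation R V) {k : ℕ} (α : V [⋀^Fin k]→ₗ[R] R) (X : Fin k → V) :
    D.onForm α X = D.fn (α X) - ∑ i, α (Function.update X i (D.vf (X i))) := rfl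

lemma onVForm_apply (D : TensorDerivation R V) {l : ℕ} (A : V [⋀^Fin l]→ₗ[R] V) (X : Fin l → V) :
    D.onVForm A X = D.vf (A X) - ∑ i, A (Function.update X i (D.vf (X i))) := rfl

/-- The commutator of two derivations acts on forms as the commutator of their actions. -/
lemma onForm_onForm_sub {D₁ D₂ D₃ : TensorDerivation R V}
    (hfn : ∀ f, D₃.fn f = D₁.fn (D₂.fn f) - D₂.fn (D₁.fn f))
    (hvf : ∀ x, D₃.vf x = D₁.vf (D₂.vf x) - D₂.vf (D₁.vf x)) {k : ℕ} (α : V [⋀^Fin k]→ₗ[R] R)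
    (X : Fin k → V) :
    D₃.onForm α X = D₁.onForm (D₂.onForm α) X - D₂.onForm (D₁.onForm α) X := by
  -- In different slots the two substitutions commute; in the same slot they differ by the
  -- commutator `D₃`.
  have key : ∀ i j,
      α (Function.update (Function.update X i (D₁.vf (X i))) j
          (D₂.vf (Function.update X i (D₁.vf (X i)) j))) =
        α (Function.update (Function.update X j (D₂.vf (X j))) i
          (D₁.vf (Function.update X j (D₂.vf (X j)) i))) -
        if i = j then α (Function.update X i (D₃.vf (X i))) else 0 := by
    intro i j
    by_cases h : i = j
    · subst h
      simp [hvf, α.map_update_sub]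
    · rw [if_neg h, sub_zero, Function.update_of_ne (Ne.symm h), Function.update_of_ne h,
        Function.update_comm h]
  have hsum := Finset.sum_congr rfl fun i (_ : i ∈ Finset.univ) =>
    Finset.sum_congr rfl fun j (_ : j ∈ Finset.univ) => key i j
  simp only [Finset.sum_sub_distrib, Finset.sum_ite_eq, Finset.mem_univ, if_true] at hsum
  rw [Finset.sum_comm (f := fun i j => α (Function.update (Function.update X j (D₂.vf (X j))) i
          (D₁.vf (Function.update X j (D₂.vf (X j)) i))))] at hsum
  simp only [onForm_apply, map_sub, map_sum, Finset.sum_sub_distrib, hfn]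
  linear_combination -hsum

/-- The Leibniz rule for the alternatization of a multilinear map. -/
lemma onForm_alternatization (D : TensorDerivation R V) {m : ℕ}
    (f : MultilinearMap R (fun _ : Fin m => V) R) (X : Fin m → V) :
    D.onForm (MultilinearMap.alternatization f) X =
      ∑ σ : Equiv.Perm (Fin m), Equiv.Perm.sign σ • (D.fn (f (X ∘ σ)) -
        ∑ i, f (Function.update (X ∘ σ) i (D.vf (X (σ i))))) := by
  have hterm : ∀ σ : Equiv.Perm (Fin m),
      ∑ i, f (fun j => Function.update X i (D.vf (X i)) (σ j)) =
        ∑ i, f (Function.update (X ∘ σ) i (D.vf (X (σ i)))) := by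
    intro σ
    rw [← Equiv.sum_comp σ]
    refine Finset.sum_congr rfl fun i _ => congrArg f ?_
    exact Function.update_comp_eq_of_injective X σ.injective i _
  have hfn : ∀ (z : ℤˣ) (r : R), D.fn (z • r) = z • D.fn r := by
    intro z r
    rw [Units.smul_def, Units.smul_def, map_zsmul]
  simp only [onForm_apply, MultilinearMap.alternatization_apply, MultilinearMap.domDomCongr_apply,
    map_sum, hfn]
  rw [Finset.sum_comm, ← Finset.sum_sub_distrib]
  refine Finset.sum_congr rfl fun σ _ => ?_
  rw [← Finset.smul_sum, hterm, smul_sub]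
  rfl

/-- The first `l` slots differentiate the arguments of `A`, the other `k` those of `α`. The term
with `D` applied to the value of `A` occurs with opposite signs in `Dα` and `DA`, and cancels. -/
lemma insertFront_leibniz (D : TensorDerivation R V) {k l m : ℕ} (h : m = k + l)
    (A : V [⋀^Fin l]→ₗ[R] V) (α : V [⋀^Fin (k + 1)]→ₗ[R] R) (X : Fin m → V) :
    D.fn (insertFront h A α X) - ∑ i, insertFront h A α (Function.update X i (D.vf (X i))) =
      insertFront h A (D.onForm α) X + insertFront h (D.onVForm A) α X := by
  have hsum : ∀ f : Fin m → R, ∑ i, f i =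
      ∑ i : Fin l, f ⟨i, by omega⟩ + ∑ j : Fin k, f ⟨l + j, by omega⟩ := by
    intro f
    obtain rfl : m = l + k := by omega
    exact Fin.sum_univ_add f
  -- Linearity of `α` in its first slot, bundled so that `map_sub` and `map_sum` can expand `DA`
  -- there.
  let α' : V →ₗ[R] (Fin k → V) → R :=
    { toFun := fun x Y => α (Fin.cons x Y)
      map_add' := fun x y => funext fun Y => α.map_vecCons_add _ _ _
      map_smul' := fun c x => funext fun Y => α.map_vecCons_smul _ _ _ }
  have hα' : ∀ x Y, α (Fin.cons x Y) = α' x Y := fun _ _ => rfl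
  have hA : ∀ B X, insertFront h B α X = α' (B fun i : Fin l => X ⟨i, by omega⟩)
    fun j : Fin k => X ⟨l + j, by omega⟩ := fun _ _ => rfl
  have hA' : insertFront h A (D.onForm α) X = D.onForm α
    (Fin.cons (A fun i : Fin l => X ⟨i, by omega⟩) fun j : Fin k => X ⟨l + j, by omega⟩) := rfl
  rw [hA', onForm_apply, Fin.sum_univ_succ, hsum]
  simp only [hA, hα', Fin.cons_zero, Fin.cons_succ, Fin.update_cons_zero, ← Fin.cons_update,
    onVForm_apply, map_sub, map_sum, Pi.sub_apply, Finset.sum_apply]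
  have h1 : ∀ i : Fin l, (fun j : Fin l => Function.update X ⟨i, by omega⟩
      (D.vf (X ⟨i, by omega⟩)) ⟨j, by omega⟩) =
      Function.update (fun j : Fin l => X ⟨j, by omega⟩) i (D.vf (X ⟨i, by omega⟩)) :=
    fun i => front_update_lt h i.2
  have h2 : ∀ i : Fin l, (fun j : Fin k => Function.update X ⟨i, by omega⟩
      (D.vf (X ⟨i, by omega⟩)) ⟨l + j, by omega⟩) = (fun j : Fin k => X ⟨l + j, by omega⟩) :=
    fun i => front_update_lt' h i.2
  have h3 : ∀ i : Fin k, (fun j : Fin l => Function.update X ⟨l + i, by omega⟩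
      (D.vf (X ⟨l + i, by omega⟩)) ⟨j, by omega⟩) = fun j : Fin l => X ⟨j, by omega⟩ :=
    fun i => front_update_ge h (by simp)
  have h4 : ∀ i : Fin k, (fun j : Fin k => Function.update X ⟨l + i, by omega⟩
      (D.vf (X ⟨l + i, by omega⟩)) ⟨l + j, by omega⟩) =
      Function.update (fun j : Fin k => X ⟨l + j, by omega⟩) i (D.vf (X ⟨l + i, by omega⟩)) := by
    intro i
    rw [front_update_ge' h (by simp)]
    congr 1
    ext
    simp
  simp only [h1, h2, h3, h4]
  ring

/-- `D i_A - i_A D = i_{DA}`. -/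
theorem onForm_insertion_sub (D : TensorDerivation R V) {k l m : ℕ} (h : m + 1 = k + l)
    (A : V [⋀^Fin l]→ₗ[R] V) (α : V [⋀^Fin k]→ₗ[R] R) :
    D.onForm (insertion A h α) - insertion A h (D.onForm α) = insertion (D.onVForm A) h α := by
  ext X
  cases k with
  | zero =>
    change D.onForm 0 X - 0 = 0
    simp [onForm_apply]
  | succ k =>
    have hsmul : ∀ (c : ℝ) (β : V [⋀^Fin m]→ₗ[R] R), D.onForm (c • β) = c • D.onForm β := by
      intro c β
      ext Y
      simp only [onForm_apply, AlternatingMap.smul_apply, D.fn.map_smul, smul_sub, Finset.smul_sum]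
    simp only [insertion, hsmul, ← smul_sub, AlternatingMap.sub_apply, AlternatingMap.smul_apply]
    congr 1
    rw [onForm_alternatization]
    simp only [MultilinearMap.alternatization_apply, MultilinearMap.domDomCongr_apply]
    rw [← Finset.sum_sub_distrib]
    refine Finset.sum_congr rfl fun σ _ => ?_
    rw [← smul_sub]
    congr 1
    have := D.insertFront_leibniz (show m = k + l by omega) A α (X ∘ σ)
    simp only [Function.comp_apply] at this
    rw [this]
    exact add_sub_cancel_left _ _

end TensorDerivation

/-- `B` acts trivially on functions, so it enters only through the slots, with a minus sign, and the
sum over the slots is `i_B`. -/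
lemma TensorDerivation.onForm_addEnd [IsScalarTower ℝ R V] (D : TensorDerivation R V)
    (B : V →ₗ[R] V) {k : ℕ} (α : V [⋀^Fin k]→ₗ[R] R) :
    (D.addEnd B).onForm α = D.onForm α - insertion (ofEnd B) rfl α := by
  ext X
  rw [AlternatingMap.sub_apply, insertion_ofEnd_apply, onForm_apply, onForm_apply, sub_sub,
    ← Finset.sum_add_distrib]
  simp only [← α.map_update_add]
  rfl

lemma koszul_sub (D : V → TensorDerivation R V) {k : ℕ} (α β : V [⋀^Fin k]→ₗ[R] R)
    (X : Fin (k + 1) → V) : koszul D (α - β) X = koszul D α X - koszul D β X := by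
  have hite : ∀ (p : Prop) [Decidable p] (r s : R),
      (if p then r - s else 0) = (if p then r else 0) - if p then s else 0 := by
    intro p _ r s; split_ifs <;> simp
  simp only [koszul, AlternatingMap.sub_apply, map_sub, mul_sub, hite, Finset.sum_sub_distrib]
  ring

/-- A derivation that commutes with the family `D` commutes with Koszul's operator. -/
theorem koszul_onForm (D : V → TensorDerivation R V) (L : TensorDerivation R V)
    (hfn : ∀ x f, (D (L.vf x)).fn f = L.fn ((D x).fn f) - (D x).fn (L.fn f))
    (hvf : ∀ x y, (D (L.vf x)).vf y = L.vf ((D x).vf y) - (D x).vf (L.vf y)) {k : ℕ}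
    (α : V [⋀^Fin k]→ₗ[R] R) (X : Fin (k + 1) → V) :
    koszul D (L.onForm α) X =
      L.fn (koszul D α X) - ∑ i, koszul D α (Function.update X i (L.vf (X i))) := by
  induction k with
  | zero =>
    simp [koszul_zero_form, TensorDerivation.onForm_apply, hfn]
  | succ k ih =>
    obtain ⟨x, Y, rfl⟩ : ∃ x Y, X = Fin.cons x Y := ⟨X 0, Fin.tail X, (Fin.cons_self_tail X).symm⟩
    -- This is `i_x L = L i_x - i_{Lx}`. With Cartan's formula it reduces the claim for `α` to the
    -- claim for `i_x α`, of one degree less.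
    have hc : (L.onForm α).curryLeft x = L.onForm (α.curryLeft x) - α.curryLeft (L.vf x) := by
      ext Z
      have h1 : (L.onForm α).curryLeft x Z = L.onForm α (Fin.cons x Z) := rfl
      have h2 : ∀ y W, α.curryLeft y W = α (Fin.cons y W) := fun _ _ => rfl
      rw [AlternatingMap.sub_apply, h1, TensorDerivation.onForm_apply, Fin.sum_univ_succ,
        TensorDerivation.onForm_apply]
      simp only [h2, Fin.cons_zero, Fin.cons_succ, Fin.update_cons_zero, ← Fin.cons_update]
      ring
    rw [Fin.sum_univ_succ]
    simp only [Fin.cons_zero, Fin.cons_succ, Fin.update_cons_zero, ← Fin.cons_update, koszul_cons,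
      hc, koszul_sub, ih, TensorDerivation.onForm_onForm_sub (hfn x) (hvf x), map_sub,
      Finset.sum_sub_distrib]
    rw [TensorDerivation.onForm_apply L ((D x).onForm α)]
    ring

end Algebra

/-! ### The exterior derivative against `ℒ_S` and `∇`. -/

section Manifold

variable {E : Type*} [NormedAddCommGroup E] [NormedSpace ℝ E]
  {H : Type*} [TopologicalSpace H] {I : ModelWithCorners ℝ E H}
  {N : Type*} [TopologicalSpace N] [ChartedSpace H N] [IsManifold I ∞ N] [CompleteSpace E]

lemma extDer_sub {k : ℕ} (α β : Form I N k) : extDer (α - β) = extDer α - extDer β := by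
  ext1 X
  exact koszul_sub lieD α β X

/-- The exterior derivative commutes with the Lie derivative. -/
theorem extDer_onForm_lieD {S : VField I N}
    (h : ∀ (X : VField I N) f, (S.bracket X).apply f = S.apply (X.apply f) - X.apply (S.apply f))
    {k : ℕ} (α : Form I N k) : extDer ((lieD S).onForm α) = (lieD S).onForm (extDer α) := by
  ext1 X
  -- The commutator rule on functions is `h`; on vector fields it is the Jacobi identity.
  refine koszul_onForm lieD (lieD S) h (fun x y => ?_) α X
  exact eq_sub_of_add_eq (S.bracket_jacobi x y).symm

end Manifold

section SlitTangentBundle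

variable {E : Type*} [NormedAddCommGroup E] [NormedSpace ℝ E]
  {H : Type*} [TopologicalSpace H] {I : ModelWithCorners ℝ E H}
  {M : Type*} [TopologicalSpace M] [ChartedSpace H M] [IsManifold I ∞ M]
  [CompleteSpace E] {S : VField I.tangent (Slit I M)}

/-- `d∇ - ∇d = d_Ψ`. -/
theorem IsSemispray.extDer_dynCovDeriv [FiniteDimensional ℝ E] [T2Space M] (hS : IsSemispray S) {k : ℕ}
    (α : Form I.tangent (Slit I M) k) :
    extDer ((dynCovDeriv S).onForm α) - (dynCovDeriv S).onForm (extDer α) =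
      dAlong (Psi S) α := by
  rw [dynCovDeriv, TensorDerivation.onForm_addEnd, TensorDerivation.onForm_addEnd, extDer_sub,
    extDer_onForm_lieD (fun X f => hS.apply_bracket S X f), dAlong]
  -- The common term `ℒ_S dα` drops out, leaving `i_Ψ dα - d i_Ψ α`.
  exact sub_sub_sub_cancel_left _ _ _

/-- If `∇A = 0`, then `∇` commutes with `i_A`. -/
theorem onForm_insertion_of_onEnd_eq_zero {A : End I.tangent (Slit I M)}
    (hA : (dynCovDeriv S).onEnd A = 0) {k : ℕ} (α : Form I.tangent (Slit I M) k) :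
    (dynCovDeriv S).onForm (insertion (ofEnd A) rfl α) -
      insertion (ofEnd A) rfl ((dynCovDeriv S).onForm α) = 0 := by
  have h0 : ofEnd (0 : End I.tangent (Slit I M)) = 0 := by
    ext1 X; rfl
  rw [TensorDerivation.onForm_insertion_sub, onVForm_ofEnd, hA, h0, insertion_zero]

end SlitTangentBundle

end TensorCalculus

end

theorem mainTheorem6 (n : ℕ) (hn : 1 ≤ n) {M : Type*} [TopologicalSpace M] [T2Space M]
    [SecondCountableTopology M] [ChartedSpace (EuclideanSpace ℝ (Fin n)) M]
    [IsManifold (𝓡 n) ∞ M] (S : VField (𝓡 n).tangent (Slit (𝓡 n) M)) (hS : IsSemispray S) :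
    -- `∇ = ℒ_S + Ψ` is the unique dynamical covariant derivative of `S`
    (∀ D, IsDynCovDeriv S D ↔ D = dynCovDeriv S) ∧
    -- `∇h = 0`, `∇v = 0`, and `∇` preserves the horizontal and the vertical distribution
    (dynCovDeriv S).onEnd (horProj S) = 0 ∧
    (dynCovDeriv S).onEnd (verProj S) = 0 ∧
    (∀ X, horProj S X = X → horProj S ((dynCovDeriv S).vf X) = (dynCovDeriv S).vf X) ∧
    (∀ X : VField (𝓡 n).tangent (Slit (𝓡 n) M), (∀ u, dproj u (X u) = 0) →
      ∀ u, dproj u ((dynCovDeriv S).vf X u) = 0) ∧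
    -- `∇J = 0`, `∇𝔽 = 0`
    (dynCovDeriv S).onEnd (tangentStructure (𝓡 n) M) = 0 ∧
    (dynCovDeriv S).onEnd (almostComplex S) = 0 ∧
    -- `d∇ - ∇d = d_Ψ` on `k`-forms, `k ≥ 0`
    (∀ (k : ℕ) (α : Form (𝓡 n).tangent (Slit (𝓡 n) M) k),
      extDer ((dynCovDeriv S).onForm α) - (dynCovDeriv S).onForm (extDer α) =
        dAlong (Psi S) α) ∧
    -- `∇ i_A - i_A ∇ = i_{∇A}` on `k`-forms, for every vector valued `l`-form `A`
    (∀ (k l m : ℕ) (hm : m + 1 = k + l) (A : VForm (𝓡 n).tangent (Slit (𝓡 n) M) l)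
      (α : Form (𝓡 n).tangent (Slit (𝓡 n) M) k),
      (dynCovDeriv S).onForm (insertion A hm α) - insertion A hm ((dynCovDeriv S).onForm α) =
        insertion ((dynCovDeriv S).onVForm A) hm α) ∧
    -- `∇ i_A - i_A ∇ = 0` for `A ∈ {h, v, J, Γ, 𝔽}`
    (∀ A : End (𝓡 n).tangent (Slit (𝓡 n) M),
      A = horProj S ∨ A = verProj S ∨ A = tangentStructure (𝓡 n) M ∨ A = almostProduct S ∨
        A = almostComplex S →
      ∀ (k : ℕ) (α : Form (𝓡 n).tangent (Slit (𝓡 n) M) k),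
        (dynCovDeriv S).onForm (insertion (ofEnd A) rfl α) -
          insertion (ofEnd A) rfl ((dynCovDeriv S).onForm α) = 0) := by 
  refine ⟨hS.isDynCovDeriv_iff, hS.onEnd_horProj, hS.onEnd_verProj, fun X hX => ?_, fun X hX => ?_,
    hS.onEnd_tangentStructure, hS.onEnd_almostComplex, fun k α => hS.extDer_dynCovDeriv α,
    fun k l m hm A α => (dynCovDeriv S).onForm_insertion_sub hm A α, ?_⟩
  · rw [← hS.dynCovDeriv_horProj, hX]
  · rw [← tangentStructure_eq_zero_iff] at hX ⊢
    exact hS.tangentStructure_dynCovDeriv hX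
  · rintro A (rfl | rfl | rfl | rfl | rfl) k α
    · exact onForm_insertion_of_onEnd_eq_zero hS.onEnd_horProj α
    · exact onForm_insertion_of_onEnd_eq_zero hS.onEnd_verProj α
    · exact onForm_insertion_of_onEnd_eq_zero hS.onEnd_tangentStructure α
    · exact onForm_insertion_of_onEnd_eq_zero hS.onEnd_almostProduct α
    · exact onForm_insertion_of_onEnd_eq_zero hS.onEnd_almostComplex α
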